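/- Let $G$ be a finite group. Let $\mathcal D(G)$ be the category of finite left $G$-sets and $G$-maps. A bivariant functor $M$ on $\mathcal D(G)$ with values in a category $\mathcal C$ consists of a covariant functor $M_*$ and a contravariant functor $M^*$ from $\mathcal D(G)$ to $\mathcal C$ that agree on objects, $M(S)=M_*(S)=M^*(S)$. A Mackey functor is a bivariant functor $M\colon\mathcal D(G)\to\mathcal{A}b$ with values in abelian groups such that (M1) for every pullback square of finite $G$-sets with maps $\Psi\colon S\to S_1$, $\Phi\colon S\to S_2$, $\varphi\colon S_1\to T$, $\psi\colon S_2\to T$ one has $M^*(\varphi)\circ M_*(\psi)=M_*(\Psi)\circ M^*(\Phi)$, and (M2) for all $S_1,S_2$ the embeddings into the disjoint union induce an isomorphism $M^*(S_1\sqcup S_2)\to M^*(S_1)\oplus M^*(S_2)$, and $M(\emptyset)=0$. It is conjugation invariant if, for every subgroup $H\subseteq G$ and every $z\in C_G(H)$, the $G$-map $\varphi_z\colon G/H\to G/H$, $eH\mapsto zH$, satisfies $M_*(\varphi_z)=\mathrm{id}$. For subgroups $K,H\subseteq G$, a conjugation $K$-$H$ biset is a finite set $X$ with commuting free actions of $K$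 from the left and $H$ from the right such that for every $x\in X$ there is $g\in G$ with $h=g^{-1}kg$ whenever $k\in K$, $h\in H$ and $kx=xh$. Let $\mathbf B(G)$ be the category whose objects are the subgroups of $G$, whose group of morphisms from $H_1$ to $H_2$ is the Grothendieck group of the isomorphism classes of conjugation $H_2$-$H_1$ bisets under disjoint union, and whose composition is induced by the balanced product $X\circ Y=X\times_{H_2}Y$. Let $\mathbf B_\bullet(G)$ be its additive completion (objects: finite tuples of subgroups; morphisms: matrices of morphisms of $\mathbf B(G)$). Choose for every finite $G$-set $S$ an ordered collection $b_1,\dots,b_n$ of base points, one in each $G$-orbit. The bivariant functor $j\colon\mathcal D(G)\to\mathbf B_\bullet(G)$ sends $S$ to the tuple of the stabilizers $G_{b_1},\dots,G_{b_n}$. For a $G$-map $f\colon S\to T$, where $c_1,\dots,c_m$ are the base points of $T$, $H=G_{b_i}$ and $K=G_{c_k}$, the component of $j_*(f)$ from $H$ to $K$ is the class of the $K$-$H$ biset $\{x\in G\mid x f(b_i)=c_k\}$, and the component of $j^*(f)$ from $K$ to $H$ is the class of the $H$-$K$ biset $\{x\in G\mid x c_k=f(b_i)\}$, with the actions by multiplication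 in $G$. (If $f(b_i)=g c_k$, the first biset is isomorphic to $K$ with $K$ acting by left multiplication and $h\in H$ acting by right multiplication by $g^{-1}hg$; if $f(b_i)$ is not in the orbit of $c_k$, both bisets are empty and the components are $0$.) Then, for every such choice of base points: 1. If $F\colon\mathbf B_\bullet(G)\to\mathcal{A}b$ is an additive functor, then $F\circ j\colon\mathcal D(G)\to\mathcal{A}b$ is a conjugation invariant Mackey functor. 2. Conversely, every conjugation invariant Mackey functor $M$ factors uniquely through an additive functor out of $\mathbf B_\bullet(G)$, in the following sense: there are an additive functor $F\colon\mathbf B_\bullet(G)\to\mathcal{A}b$ and a natural isomorphism of bivariant functors $\eta\colon F\circ j\cong M$, and for every additive functor $F'\colon\mathbf B_\bullet(G)\to\mathcal{A}b$ with a natural isomorphism $\eta'\colon F'\circ j\cong M$ there is exactly one natural isomorphism $\theta\colon F\cong F'$ such that $\eta'_S\circ\theta_{j(S)}=\eta_S$ for all finite $G$-sets $S$. -/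

import Mathlib

open CategoryTheory

universe u w

namespace BisetMackey

noncomputable section

/-! ### The category of finite `G`-sets -/

/-- A finite left `G`-set. -/
structure FinGSet (G : Type u) [Group G] where
  /-- the underlying set -/
  carrier : Type u
  [action : MulAction G carrier]
  [finite : Finite carrier]

namespace FinGSet

variable {G : Type u} [Group G]

instance : CoeSort (FinGSet G) (Type u) := ⟨FinGSet.carrier⟩

attribute [instance] FinGSet.action FinGSet.finite

/-- The Dress category: finite left `G`-sets and `G`-maps. -/
instance : Category (FinGSet G) where
  Hom X Y := X →[G] Y
  id X := MulActionHom.id G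
  comp f g := MulActionHom.comp g f

instance : ConcreteCategory (FinGSet G) (fun X Y => X →[G] Y) where
  hom f := f
  ofHom f := f

/-- The disjoint union of two finite `G`-sets. -/
def sum (S T : FinGSet G) : FinGSet G :=
  { carrier := S ⊕ T
    action :=
      { smul := fun g => Sum.map (g • ·) (g • ·)
        one_smul := by
          rintro (x | x)
          · exact congrArg Sum.inl (one_smul G x)
          · exact congrArg Sum.inr (one_smul G x)
        mul_smul := by
          rintro g h (x | x)
          · exact congrArg Sum.inl (mul_smul g h x)
          · exact congrArg Sum.inr (mul_smul g h x) } }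

/-- The embedding of the first summand. -/
def inl (S T : FinGSet G) : S ⟶ S.sum T :=
  { toFun := Sum.inl, map_smul' := fun _ _ => rfl : S →[G] S.sum T }

/-- The embedding of the second summand. -/
def inr (S T : FinGSet G) : T ⟶ S.sum T :=
  { toFun := Sum.inr, map_smul' := fun _ _ => rfl : T →[G] S.sum T }

/-- The empty `G`-set. -/
def empty (G : Type u) [Group G] : FinGSet G :=
  { carrier := PEmpty
    action := { smul := fun _ x => x, one_smul := fun _ => rfl, mul_smul := fun _ _ _ => rfl } }

/-- The orbit `G/H`. -/
def quot [Finite G] (H : Subgroup G) : FinGSet G := { carrier := G ⧸ H }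

end FinGSet

/-! ### Bivariant functors and Mackey functors -/

/-- A bivariant functor `C → A`: a covariant functor `(obj, map)` and a contravariant functor
`(obj, comap)` that agree on objects. -/
structure Bivariant (C : Type*) [Category C] (A : Type*) [Category A] where
  /-- the common value on objects -/
  obj : C → A
  /-- the covariant maps -/
  map : ∀ {S T : C}, (S ⟶ T) → (obj S ⟶ obj T)
  /-- the contravariant maps -/
  comap : ∀ {S T : C}, (S ⟶ T) → (obj T ⟶ obj S)
  map_id : ∀ S : C, map (𝟙 S) = 𝟙 (obj S)
  map_comp : ∀ {S T U : C} (f : S ⟶ T) (g : T ⟶ U), map (f ≫ g) = map f ≫ map g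
  comap_id : ∀ S : C, comap (𝟙 S) = 𝟙 (obj S)
  comap_comp : ∀ {S T U : C} (f : S ⟶ T) (g : T ⟶ U), comap (f ≫ g) = comap g ≫ comap f

namespace Bivariant

variable {C : Type*} [Category C] {A : Type*} [Category A] {B : Type*} [Category B]

/-- The composite `F ∘ M` of a bivariant functor `M` with a functor `F`. -/
def postcomp (M : Bivariant C A) (F : A ⥤ B) : Bivariant C B where
  obj S := F.obj (M.obj S)
  map f := F.map (M.map f)
  comap f := F.map (M.comap f)
  map_id S := by rw [M.map_id, F.map_id]
  map_comp f g := by rw [M.map_comp, F.map_comp]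
  comap_id S := by rw [M.comap_id, F.map_id]
  comap_comp f g := by rw [M.comap_comp, F.map_comp]

/-- A natural isomorphism of bivariant functors: a family of isomorphisms that is natural for the
covariant and for the contravariant maps. -/
structure NatIso (M N : Bivariant C A) where
  /-- the components -/
  app : ∀ S : C, M.obj S ≅ N.obj S
  map_naturality : ∀ {S T : C} (f : S ⟶ T), M.map f ≫ (app T).hom = (app S).hom ≫ N.map f
  comap_naturality : ∀ {S T : C} (f : S ⟶ T), M.comap f ≫ (app S).hom = (app T).hom ≫ N.comap f

end Bivariant

/-- A Mackey functor (in the sense of Dress): a bivariant functor from finite `G`-sets to abelian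
groups that satisfies the pullback axiom and the additivity axiom. -/
structure IsMackey {G : Type u} [Group G] (M : Bivariant (FinGSet G) AddCommGrpCat.{w}) :
    Prop where
  pullback : ∀ {S S₁ S₂ T : FinGSet G} {Ψ : S ⟶ S₁} {Φ : S ⟶ S₂} {φ : S₁ ⟶ T} {ψ : S₂ ⟶ T},
    IsPullback Ψ Φ φ ψ → M.map ψ ≫ M.comap φ = M.comap Φ ≫ M.map Ψ
  additive : ∀ S₁ S₂ : FinGSet G, Function.Bijective
    (fun x : M.obj (S₁.sum S₂) =>
      ((M.comap (FinGSet.inl S₁ S₂) x, M.comap (FinGSet.inr S₁ S₂) x) : M.obj S₁ × M.obj S₂))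
  empty : Subsingleton (M.obj (FinGSet.empty G))

/-- `M` is conjugation invariant: for every subgroup `H` and every `z` in the centralizer of `H`,
the `G`-map `φ_z : G/H → G/H`, `eH ↦ zH`, induces the identity of `M(G/H)`. -/
def IsConjInvariant {G : Type u} [Group G] [Finite G]
    (M : Bivariant (FinGSet G) AddCommGrpCat.{w}) : Prop :=
  ∀ (H : Subgroup G) (z : G), z ∈ Subgroup.centralizer (H : Set G) →
    ∀ φ : FinGSet.quot H ⟶ FinGSet.quot H,
      φ ((1 : G) : G ⧸ H) = ((z : G) : G ⧸ H) → M.map φ = 𝟙 (M.obj (FinGSet.quot H))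

/-! ### Conjugation bisets -/

/-- A finite bifree `K`-`H` biset for subgroups `K`, `H` of `G`: a finite set with commuting free
actions of `K` from the left and of `H` from the right (`MulOpposite.op h • x` is `x · h`). -/
structure BifreeBiset {G : Type u} [Group G] (K H : Subgroup G) where
  /-- the underlying set -/
  carrier : Type u
  [finite : Finite carrier]
  [left : MulAction K carrier]
  [right : MulAction Hᵐᵒᵖ carrier]
  comm : ∀ (k : K) (h : H) (x : carrier),
    k • MulOpposite.op h • x = MulOpposite.op h • k • x
  left_free : ∀ (k : K) (x : carrier), k • x = x → k = 1
  right_free : ∀ (h : H) (x : carrier), MulOpposite.op h • x = x → h = 1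

attribute [instance] BifreeBiset.finite BifreeBiset.left BifreeBiset.right

variable {G : Type u} [Group G]

namespace BifreeBiset

open MulOpposite

instance {K H : Subgroup G} (X : BifreeBiset K H) : SMulCommClass K Hᵐᵒᵖ X.carrier :=
  ⟨fun k h x => X.comm k (unop h) x⟩

instance (K H : Subgroup G) : CoeSort (BifreeBiset K H) (Type u) := ⟨BifreeBiset.carrier⟩

/-- For a point `x` of a bifree biset put `L_x = {k | k x ∈ x H}`, and let `γ_x : L_x → H` be the
injective homomorphism with `γ_x k = h ↔ k x = x h`; this is the standard representation at `x`.
A conjugation biset is one for which every `γ_x` is of the form `c_g : k ↦ g⁻¹ k g` with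
`g ∈ G`. -/
def IsConjugation {K H : Subgroup G} (X : BifreeBiset K H) : Prop :=
  ∀ x : X, ∃ g : G, ∀ (k : K) (h : H), k • x = op h • x → (h : G) = g⁻¹ * (k : G) * g

end BifreeBiset

/-- A finite bifree conjugation `K`-`H` biset. -/
structure ConjBiset (K H : Subgroup G) extends BifreeBiset K H where
  isConjugation : toBifreeBiset.IsConjugation

namespace ConjBiset

open MulOpposite

variable {K H L N : Subgroup G}

instance (K H : Subgroup G) : CoeSort (ConjBiset K H) (Type u) := ⟨fun X => X.carrier⟩

/-- Two bisets are isomorphic if there is a bijection that respects both actions. -/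
def Iso (X Y : ConjBiset K H) : Prop :=
  ∃ e : X ≃ Y, (∀ (k : K) (x : X), e (k • x) = k • e x) ∧
    ∀ (h : H) (x : X), e (op h • x) = op h • e x

/-- Isomorphism of bisets as an equivalence relation. -/
instance setoid (K H : Subgroup G) : Setoid (ConjBiset K H) where
  r := Iso
  iseqv :=
    { refl := fun X => ⟨Equiv.refl _, fun _ _ => rfl, fun _ _ => rfl⟩
      symm := by
        rintro X Y ⟨e, h₁, h₂⟩
        exact ⟨e.symm, fun k x => by rw [Equiv.symm_apply_eq, h₁, Equiv.apply_symm_apply],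
          fun k x => by rw [Equiv.symm_apply_eq, h₂, Equiv.apply_symm_apply]⟩
      trans := by
        rintro X Y Z ⟨e, h₁, h₂⟩ ⟨f, h₃, h₄⟩
        exact ⟨e.trans f, fun k x => by simp [h₁, h₃], fun k x => by simp [h₂, h₄]⟩ }

/-- The empty biset. -/
def empty (K H : Subgroup G) : ConjBiset K H where
  carrier := PEmpty
  left := { smul := fun _ x => x, one_smul := fun _ => rfl, mul_smul := fun _ _ _ => rfl }
  right := { smul := fun _ x => x, one_smul := fun _ => rfl, mul_smul := fun _ _ _ => rfl }
  comm := fun _ _ _ => rfl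
  left_free := fun _ x => x.elim
  right_free := fun _ x => x.elim
  isConjugation := fun x => x.elim

/-- The disjoint union of two bisets. -/
def sum (X Y : ConjBiset K H) : ConjBiset K H where
  carrier := X ⊕ Y
  left :=
    { smul := fun k => Sum.map (k • ·) (k • ·)
      one_smul := by
        rintro (x | x)
        · exact congrArg Sum.inl (one_smul _ x)
        · exact congrArg Sum.inr (one_smul _ x)
      mul_smul := by
        rintro g h (x | x)
        · exact congrArg Sum.inl (mul_smul g h x)
        · exact congrArg Sum.inr (mul_smul g h x) }
  right :=
    { smul := fun k => Sum.map (k • ·) (k • ·)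
      one_smul := by
        rintro (x | x)
        · exact congrArg Sum.inl (one_smul _ x)
        · exact congrArg Sum.inr (one_smul _ x)
      mul_smul := by
        rintro g h (x | x)
        · exact congrArg Sum.inl (mul_smul g h x)
        · exact congrArg Sum.inr (mul_smul g h x) }
  comm := by
    rintro k h (x | x)
    · exact congrArg Sum.inl (X.comm k h x)
    · exact congrArg Sum.inr (Y.comm k h x)
  left_free := by
    rintro k (x | x) h
    · exact X.left_free k x (Sum.inl_injective h)
    · exact Y.left_free k x (Sum.inr_injective h)
  right_free := by
    rintro k (x | x) h
    · exact X.right_free k x (Sum.inl_injective h)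
    · exact Y.right_free k x (Sum.inr_injective h)
  isConjugation := by
    rintro (x | x)
    · obtain ⟨g, hg⟩ := X.isConjugation x
      exact ⟨g, fun k h e => hg k h (Sum.inl_injective e)⟩
    · obtain ⟨g, hg⟩ := Y.isConjugation x
      exact ⟨g, fun k h e => hg k h (Sum.inr_injective e)⟩

/-- The relation `(x h, y) ~ (x, h y)` on `X × Y`. -/
def balancedSetoid (X : ConjBiset K H) (Y : ConjBiset H L) : Setoid (X × Y) where
  r p q := ∃ h : H, q.1 = op h • p.1 ∧ p.2 = h • q.2
  iseqv :=
    { refl := fun p => ⟨1, by simp, by simp⟩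
      symm := by
        rintro p q ⟨h, h₁, h₂⟩
        refine ⟨h⁻¹, ?_, ?_⟩
        · rw [h₁, smul_smul, ← op_mul, mul_inv_cancel, op_one, one_smul]
        · rw [h₂, smul_smul, inv_mul_cancel, one_smul]
      trans := by
        rintro p q r ⟨h, h₁, h₂⟩ ⟨h', h₃, h₄⟩
        exact ⟨h * h', by rw [h₃, h₁, smul_smul, op_mul], by rw [h₂, h₄, smul_smul]⟩ }

/-- The balanced product `X ×_H Y` of a `K`-`H` biset and an `H`-`L` biset, with the actions
`k [x, y] l = [k x, y l]`, as a bifree biset. -/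
def balancedProd (X : ConjBiset K H) (Y : ConjBiset H L) : BifreeBiset K L where
  carrier := Quotient (balancedSetoid X Y)
  finite := inferInstance
  left :=
    { smul := fun k => Quotient.map (fun p => (k • p.1, p.2)) (by
        rintro p q ⟨h, h₁, h₂⟩
        exact ⟨h, by simp only [h₁, smul_comm k], h₂⟩)
      one_smul := by
        rintro ⟨x, y⟩
        exact congrArg (Quotient.mk (balancedSetoid X Y)) (Prod.ext (one_smul K x) rfl)
      mul_smul := by
        rintro k k' ⟨x, y⟩
        exact congrArg (Quotient.mk (balancedSetoid X Y)) (Prod.ext (mul_smul k k' x) rfl) }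
  right :=
    { smul := fun l => Quotient.map (fun p => (p.1, l • p.2)) (by
        rintro p q ⟨h, h₁, h₂⟩
        exact ⟨h, h₁, by simp only [h₂, smul_comm h]⟩)
      one_smul := by
        rintro ⟨x, y⟩
        exact congrArg (Quotient.mk (balancedSetoid X Y)) (Prod.ext rfl (one_smul _ y))
      mul_smul := by
        rintro k k' ⟨x, y⟩
        exact congrArg (Quotient.mk (balancedSetoid X Y)) (Prod.ext rfl (mul_smul k k' y)) }
  comm := by rintro k l ⟨x, y⟩; rfl
  left_free := by
    rintro k ⟨x, y⟩ e
    obtain ⟨h, h₁, h₂⟩ := Quotient.exact e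
    have h1 : h = 1 := Y.left_free h y h₂.symm
    subst h1
    refine X.left_free k x ?_
    simpa using h₁.symm
  right_free := by
    rintro l ⟨x, y⟩ e
    obtain ⟨h, h₁, h₂⟩ := Quotient.exact e
    have h1 : h = 1 := X.right_free h x h₁.symm
    subst h1
    refine Y.right_free l y ?_
    simpa using h₂

theorem balancedProd_isConjugation (X : ConjBiset K H) (Y : ConjBiset H L) :
    (balancedProd X Y).IsConjugation := by
  rintro ⟨x, y⟩
  obtain ⟨a, ha⟩ := X.isConjugation x
  obtain ⟨b, hb⟩ := Y.isConjugation y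
  refine ⟨a * b, fun k l e => ?_⟩
  obtain ⟨h, h₁, h₂⟩ := Quotient.exact e
  have h₁' : k • x = op h⁻¹ • x := by
    have : x = op h • k • x := h₁
    conv_rhs => rw [this]
    rw [smul_smul, ← op_mul, mul_inv_cancel, op_one, one_smul]
  have h₂' : h⁻¹ • y = op l • y := by
    have : y = h • op l • y := h₂
    conv_lhs => rw [this]
    rw [smul_smul, inv_mul_cancel, one_smul]
  have e₁ := ha k h⁻¹ h₁'
  have e₂ := hb h⁻¹ l h₂'
  rw [e₂, e₁]
  group

/-- The balanced product `X ×_H Y` as a conjugation biset. -/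
def prod (X : ConjBiset K H) (Y : ConjBiset H L) : ConjBiset K L :=
  { balancedProd X Y with isConjugation := balancedProd_isConjugation X Y }

/-- A subset `S` of `G` with `K S H ⊆ S`, as a `K`-`H` biset under multiplication in `G`. -/
def ofSubset [Finite G] (K H : Subgroup G) (S : Set G)
    (hl : ∀ k ∈ K, ∀ x ∈ S, k * x ∈ S) (hr : ∀ h ∈ H, ∀ x ∈ S, x * h ∈ S) : ConjBiset K H where
  carrier := S
  left :=
    { smul := fun k x => ⟨k * x, hl k k.2 x x.2⟩
      one_smul := fun x => Subtype.ext (one_mul (x : G))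
      mul_smul := fun k k' x => Subtype.ext (mul_assoc (k : G) k' x) }
  right :=
    { smul := fun h x => ⟨x * (unop h : H), hr _ (unop h).2 x x.2⟩
      one_smul := fun x => Subtype.ext (mul_one (x : G))
      mul_smul := fun k k' x => Subtype.ext (mul_assoc (x : G) (unop k' : H) (unop k : H)).symm }
  comm := fun k h x => Subtype.ext (mul_assoc (k : G) x h).symm
  left_free := fun k x e => by
    have e' : (k : G) * x = x := congrArg Subtype.val e
    exact Subtype.ext (by simpa using e')
  right_free := fun h x e => by
    have e' : (x : G) * h = x := congrArg Subtype.val e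
    exact Subtype.ext (by simpa using e')
  isConjugation := fun x => ⟨x, fun k h e => by
    have e' : (k : G) * x = x * h := congrArg Subtype.val e
    rw [mul_assoc, e', inv_mul_cancel_left]⟩

/-- The identity biset: `H` with left and right multiplication. -/
def one [Finite G] (H : Subgroup G) : ConjBiset H H :=
  ofSubset H H (H : Set G) (fun _ hk _ hx => H.mul_mem hk hx) (fun _ hh _ hx => H.mul_mem hx hh)

/-- An equivariant bijection is an isomorphism of bisets. -/
theorem Iso.of_bijective {X Y : ConjBiset K H} (f : X → Y) (hf : Function.Bijective f)
    (h₁ : ∀ (k : K) (x : X), f (k • x) = k • f x)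
    (h₂ : ∀ (h : H) (x : X), f (op h • x) = op h • f x) : X.Iso Y :=
  ⟨Equiv.ofBijective f hf, h₁, h₂⟩

/-- The point `[x, y]` of the balanced product. -/
def pt {X : ConjBiset K H} {Y : ConjBiset H L} (x : X) (y : Y) : X.prod Y :=
  Quotient.mk (balancedSetoid X Y) (x, y)

section pt

variable {X : ConjBiset K H} {Y : ConjBiset H L}

theorem pt_ind {P : X.prod Y → Prop} (h : ∀ x y, P (pt x y)) (p : X.prod Y) : P p :=
  Quotient.ind (fun q => h q.1 q.2) p

theorem pt_surj (p : X.prod Y) : ∃ x y, pt x y = p :=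
  pt_ind (P := fun p => ∃ x y, pt x y = p) (fun x y => ⟨x, y, rfl⟩) p

theorem pt_eq_iff {x x' : X} {y y' : Y} :
    (pt x y : X.prod Y) = pt x' y' ↔ ∃ h : H, x' = op h • x ∧ y = h • y' :=
  Quotient.eq (r := balancedSetoid X Y)

theorem pt_balanced (x : X) (h : H) (y : Y) : (pt (op h • x) y : X.prod Y) = pt x (h • y) :=
  (pt_eq_iff.2 ⟨h, rfl, rfl⟩).symm

theorem smul_pt (k : K) (x : X) (y : Y) : k • (pt x y : X.prod Y) = pt (k • x) y := rfl

theorem op_smul_pt (l : L) (x : X) (y : Y) :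
    op l • (pt x y : X.prod Y) = pt x (op l • y) := rfl

/-- Maps out of a balanced product. -/
def ptLift {Z : Type*} (f : X → Y → Z) (hf : ∀ (x : X) (h : H) (y : Y), f (op h • x) y = f x (h • y)) :
    X.prod Y → Z :=
  Quotient.lift (fun p => f p.1 p.2) (by
    rintro ⟨x, y⟩ ⟨x', y'⟩ ⟨h, h₁, h₂⟩
    simp only at h₁ h₂
    simp only [h₁, h₂, hf])

end pt

theorem prod_congr {X X' : ConjBiset K H} {Y Y' : ConjBiset H L} (a : X.Iso X') (b : Y.Iso Y') :
    (X.prod Y).Iso (X'.prod Y') := by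
  obtain ⟨e, e₁, e₂⟩ := a
  obtain ⟨f, f₁, f₂⟩ := b
  refine Iso.of_bijective (ptLift (fun x y => pt (e x) (f y)) ?_) ⟨?_, ?_⟩ ?_ ?_
  · intro x h y
    rw [e₂, f₁, pt_balanced]
  · refine pt_ind fun x y => pt_ind fun x' y' h => ?_
    obtain ⟨h, h₁, h₂⟩ := pt_eq_iff.1 h
    refine pt_eq_iff.2 ⟨h, e.injective ?_, f.injective ?_⟩
    · rw [h₁, e₂]
    · rw [h₂, f₁]
  · refine pt_ind fun x y => ⟨pt (e.symm x) (f.symm y), ?_⟩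
    change pt (e (e.symm x)) (f (f.symm y)) = _
    rw [e.apply_symm_apply, f.apply_symm_apply]
  · refine fun k => pt_ind fun x y => ?_
    change pt (e (k • x)) (f y) = pt (k • e x) (f y)
    rw [e₁]
  · refine fun k => pt_ind fun x y => ?_
    change pt (e x) (f (op k • y)) = pt (e x) (op k • f y)
    rw [f₂]

theorem sum_prod (X X' : ConjBiset K H) (Y : ConjBiset H L) :
    ((X.prod Y).sum (X'.prod Y)).Iso ((X.sum X').prod Y) := by
  let i : X → X.sum X' := Sum.inl
  let j : X' → X.sum X' := Sum.inr
  let f : X.prod Y → (X.sum X').prod Y :=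
    ptLift (fun x y => pt (i x) y) (fun x h y => pt_balanced (X := X.sum X') (i x) h y)
  let g : X'.prod Y → (X.sum X').prod Y :=
    ptLift (fun x y => pt (j x) y) (fun x h y => pt_balanced (X := X.sum X') (j x) h y)
  refine Iso.of_bijective (Sum.elim f g) ⟨?_, ?_⟩ ?_ ?_
  · rintro (p | p) (q | q) e
    · obtain ⟨x, y, rfl⟩ := pt_surj p
      obtain ⟨x', y', rfl⟩ := pt_surj q
      obtain ⟨h, h₁, h₂⟩ := pt_eq_iff.1 e
      exact congrArg Sum.inl (pt_eq_iff.2 ⟨h, Sum.inl_injective h₁, h₂⟩)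
    · obtain ⟨x, y, rfl⟩ := pt_surj p
      obtain ⟨x', y', rfl⟩ := pt_surj q
      obtain ⟨h, h₁, h₂⟩ := pt_eq_iff.1 e
      exact absurd h₁ (fun h => Sum.inr_ne_inl h)
    · obtain ⟨x, y, rfl⟩ := pt_surj p
      obtain ⟨x', y', rfl⟩ := pt_surj q
      obtain ⟨h, h₁, h₂⟩ := pt_eq_iff.1 e
      exact absurd h₁ (fun h => Sum.inl_ne_inr h)
    · obtain ⟨x, y, rfl⟩ := pt_surj p
      obtain ⟨x', y', rfl⟩ := pt_surj q
      obtain ⟨h, h₁, h₂⟩ := pt_eq_iff.1 e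
      exact congrArg Sum.inr (pt_eq_iff.2 ⟨h, Sum.inr_injective h₁, h₂⟩)
  · refine pt_ind ?_
    rintro (x | x) y
    · exact ⟨Sum.inl (pt x y), rfl⟩
    · exact ⟨Sum.inr (pt x y), rfl⟩
  · rintro k (p | p)
    · obtain ⟨x, y, rfl⟩ := pt_surj p
      rfl
    · obtain ⟨x, y, rfl⟩ := pt_surj p
      rfl
  · rintro k (p | p)
    · obtain ⟨x, y, rfl⟩ := pt_surj p
      rfl
    · obtain ⟨x, y, rfl⟩ := pt_surj p
      rfl

theorem prod_sum (X : ConjBiset K H) (Y Y' : ConjBiset H L) :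
    ((X.prod Y).sum (X.prod Y')).Iso (X.prod (Y.sum Y')) := by
  let i : Y → Y.sum Y' := Sum.inl
  let j : Y' → Y.sum Y' := Sum.inr
  let f : X.prod Y → X.prod (Y.sum Y') :=
    ptLift (fun x y => pt x (i y)) (fun x h y => pt_balanced (Y := Y.sum Y') x h (i y))
  let g : X.prod Y' → X.prod (Y.sum Y') :=
    ptLift (fun x y => pt x (j y)) (fun x h y => pt_balanced (Y := Y.sum Y') x h (j y))
  refine Iso.of_bijective (Sum.elim f g) ⟨?_, ?_⟩ ?_ ?_
  · rintro (p | p) (q | q) e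
    · obtain ⟨x, y, rfl⟩ := pt_surj p
      obtain ⟨x', y', rfl⟩ := pt_surj q
      obtain ⟨h, h₁, h₂⟩ := pt_eq_iff.1 e
      exact congrArg Sum.inl (pt_eq_iff.2 ⟨h, h₁, Sum.inl_injective h₂⟩)
    · obtain ⟨x, y, rfl⟩ := pt_surj p
      obtain ⟨x', y', rfl⟩ := pt_surj q
      obtain ⟨h, h₁, h₂⟩ := pt_eq_iff.1 e
      exact absurd h₂ (fun h => Sum.inl_ne_inr h)
    · obtain ⟨x, y, rfl⟩ := pt_surj p
      obtain ⟨x', y', rfl⟩ := pt_surj q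
      obtain ⟨h, h₁, h₂⟩ := pt_eq_iff.1 e
      exact absurd h₂ (fun h => Sum.inr_ne_inl h)
    · obtain ⟨x, y, rfl⟩ := pt_surj p
      obtain ⟨x', y', rfl⟩ := pt_surj q
      obtain ⟨h, h₁, h₂⟩ := pt_eq_iff.1 e
      exact congrArg Sum.inr (pt_eq_iff.2 ⟨h, h₁, Sum.inr_injective h₂⟩)
  · refine pt_ind ?_
    rintro x (y | y)
    · exact ⟨Sum.inl (pt x y), rfl⟩
    · exact ⟨Sum.inr (pt x y), rfl⟩
  · rintro k (p | p)
    · obtain ⟨x, y, rfl⟩ := pt_surj p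
      rfl
    · obtain ⟨x, y, rfl⟩ := pt_surj p
      rfl
  · rintro k (p | p)
    · obtain ⟨x, y, rfl⟩ := pt_surj p
      rfl
    · obtain ⟨x, y, rfl⟩ := pt_surj p
      rfl

theorem prod_assoc (X : ConjBiset K H) (Y : ConjBiset H L) (Z : ConjBiset L N) :
    ((X.prod Y).prod Z).Iso (X.prod (Y.prod Z)) := by
  have hb : ∀ (x : X) (h : H) (y : Y) (z : Z),
      (pt (op h • x) (pt y z) : X.prod (Y.prod Z)) = pt x (pt (h • y) z) :=
    fun x h y z => pt_balanced (Y := Y.prod Z) x h (pt y z)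
  have hc : ∀ (x : X) (y : Y) (l : L) (z : Z),
      (pt x (pt (op l • y) z) : X.prod (Y.prod Z)) = pt x (pt y (l • z)) :=
    fun x y l z => congrArg (pt x) (pt_balanced y l z)
  let f : (X.prod Y).prod Z → X.prod (Y.prod Z) :=
    ptLift (fun p z => ptLift (fun x y => (pt x (pt y z) : X.prod (Y.prod Z)))
      (fun x h y => hb x h y z) p)
      (fun p l z => pt_ind (P := fun p => ptLift (fun x y => (pt x (pt y z) : X.prod (Y.prod Z)))
        (fun x h y => hb x h y z) (op l • p) = ptLift (fun x y =>
          (pt x (pt y (l • z)) : X.prod (Y.prod Z))) (fun x h y => hb x h y (l • z)) p)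
        (fun x y => hc x y l z) p)
  have hf : ∀ x y z, f (pt (pt x y) z) = pt x (pt y z) := fun _ _ _ => rfl
  refine Iso.of_bijective f ⟨?_, ?_⟩ ?_ ?_
  · intro q q' e
    obtain ⟨p, z, rfl⟩ := pt_surj q
    obtain ⟨x, y, rfl⟩ := pt_surj p
    obtain ⟨p', z', rfl⟩ := pt_surj q'
    obtain ⟨x', y', rfl⟩ := pt_surj p'
    rw [hf, hf] at e
    obtain ⟨h, h₁, h₂⟩ := pt_eq_iff.1 e
    rw [smul_pt] at h₂
    obtain ⟨l, h₃, h₄⟩ := pt_eq_iff.1 h₂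
    refine pt_eq_iff.2 ⟨l, ?_, h₄⟩
    rw [op_smul_pt, h₁, pt_balanced, h₃]
  · intro q
    obtain ⟨x, p, rfl⟩ := pt_surj q
    obtain ⟨y, z, rfl⟩ := pt_surj p
    exact ⟨pt (pt x y) z, rfl⟩
  · intro k q
    obtain ⟨p, z, rfl⟩ := pt_surj q
    obtain ⟨x, y, rfl⟩ := pt_surj p
    rfl
  · intro k q
    obtain ⟨p, z, rfl⟩ := pt_surj q
    obtain ⟨x, y, rfl⟩ := pt_surj p
    rfl

theorem one_prod [Finite G] (X : ConjBiset K H) : ((one K).prod X).Iso X := by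
  let v : (one K) → K := fun x => x
  refine Iso.of_bijective (ptLift (fun k x => v k • x) ?_) ⟨?_, ?_⟩ ?_ ?_
  · intro k h x
    exact mul_smul (v k) h x
  · refine pt_ind fun k x => pt_ind fun k' x' h => ?_
    have h' : v k • x = v k' • x' := h
    refine pt_eq_iff.2 ⟨(v k)⁻¹ * v k', ?_, ?_⟩
    · exact (mul_inv_cancel_left (v k) (v k')).symm
    · rw [mul_smul, ← h', inv_smul_smul]
  · exact fun x => ⟨pt (1 : K) x, one_smul K x⟩
  · exact fun k => pt_ind fun k' x => mul_smul k (v k') x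
  · exact fun h => pt_ind fun k' x => X.comm (v k') h x

theorem prod_one [Finite G] (X : ConjBiset K H) : (X.prod (one H)).Iso X := by
  let v : (one H) → H := fun x => x
  refine Iso.of_bijective (ptLift (fun x h => op (v h) • x) ?_) ⟨?_, ?_⟩ ?_ ?_
  · intro x h k
    exact (mul_smul (op (v k)) (op h) x).symm
  · refine pt_ind fun x h => pt_ind fun x' h' e => ?_
    have e' : op (v h) • x = op (v h') • x' := e
    refine pt_eq_iff.2 ⟨v h * (v h')⁻¹, ?_, ?_⟩
    · rw [op_mul, mul_smul, e', MulOpposite.op_inv, inv_smul_smul]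
    · exact (inv_mul_cancel_right (v h) (v h')).symm
  · exact fun x => ⟨pt x (1 : H), one_smul _ x⟩
  · exact fun k => pt_ind fun x h => (X.comm k (v h) x).symm
  · exact fun h => pt_ind fun x k => mul_smul (op h) (op (v k)) x

/-- Composition of bisets that are given by subsets of `G`. -/
theorem ofSubset_prod [Finite G] {A B C : Set G} {hA hA' hB hB' hC hC'}
    (h₁ : ∀ y ∈ A, ∀ x ∈ B, y * x ∈ C) (h₂ : ∀ z ∈ C, ∃ y ∈ A, ∃ x ∈ B, z = y * x)
    (h₃ : ∀ y ∈ A, ∀ y' ∈ A, ∀ x ∈ B, ∀ x' ∈ B, y * x = y' * x' → y⁻¹ * y' ∈ H) :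
    ((ofSubset K H A hA hA').prod (ofSubset H L B hB hB')).Iso (ofSubset K L C hC hC') := by
  let X := ofSubset K H A hA hA'
  let Y := ofSubset H L B hB hB'
  let a : X → A := fun x => x
  let b : Y → B := fun x => x
  let m : A → B → C := fun y x => ⟨y * x, h₁ y y.2 x x.2⟩
  refine Iso.of_bijective (ptLift (fun y x => m (a y) (b x)) ?_) ⟨?_, ?_⟩ ?_ ?_
  · intro y h x
    exact Subtype.ext (mul_assoc (a y : G) (h : G) (b x : G))
  · refine pt_ind fun y x => pt_ind fun y' x' e => ?_
    have e' : (a y : G) * b x = a y' * b x' := congrArg Subtype.val e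
    refine pt_eq_iff.2 ⟨⟨_, h₃ (a y) (a y).2 (a y') (a y').2 (b x) (b x).2 (b x') (b x').2 e'⟩,
      Subtype.ext ?_, Subtype.ext ?_⟩
    · exact (mul_inv_cancel_left (a y : G) (a y')).symm
    · change (b x : G) = (a y : G)⁻¹ * a y' * b x'
      rw [mul_assoc, ← e', inv_mul_cancel_left]
  · rintro ⟨z, hz⟩
    obtain ⟨y, hy, x, hx, rfl⟩ := h₂ z hz
    exact ⟨pt (X := X) (Y := Y) ⟨y, hy⟩ ⟨x, hx⟩, rfl⟩
  · exact fun k => pt_ind fun y x => Subtype.ext (mul_assoc (k : G) (a y : G) (b x : G))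
  · exact fun k => pt_ind fun y x => Subtype.ext (mul_assoc (a y : G) (b x : G) (k : G)).symm

end ConjBiset

/-- Isomorphism classes of finite bifree conjugation `K`-`H` bisets. -/
def BisetClass (K H : Subgroup G) : Type (u + 1) := Quotient (ConjBiset.setoid K H)

namespace BisetClass

open ConjBiset

variable {K H L N : Subgroup G}

/-- The isomorphism class of a biset. -/
def mk (X : ConjBiset K H) : BisetClass K H := Quotient.mk _ X

theorem mk_eq {X Y : ConjBiset K H} (e : X.Iso Y) : mk X = mk Y := Quotient.sound e

instance : Zero (BisetClass K H) := ⟨mk (ConjBiset.empty K H)⟩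

/-- Disjoint union makes the isomorphism classes of bisets a commutative monoid. -/
instance : Add (BisetClass K H) where
  add := Quotient.map₂ ConjBiset.sum (by
    rintro X X' ⟨e, h₁, h₂⟩ Y Y' ⟨f, h₃, h₄⟩
    refine ⟨Equiv.sumCongr e f, ?_, ?_⟩
    · rintro k (x | x)
      · exact congrArg Sum.inl (h₁ k x)
      · exact congrArg Sum.inr (h₃ k x)
    · rintro k (x | x)
      · exact congrArg Sum.inl (h₂ k x)
      · exact congrArg Sum.inr (h₄ k x))

instance : AddCommMonoid (BisetClass K H) where
  add_assoc := by
    rintro ⟨X⟩ ⟨Y⟩ ⟨Z⟩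
    refine mk_eq ⟨Equiv.sumAssoc X Y Z, ?_, ?_⟩
    · rintro k ((x | x) | x) <;> rfl
    · rintro k ((x | x) | x) <;> rfl
  zero_add := by
    rintro ⟨X⟩
    refine mk_eq ⟨Equiv.emptySum PEmpty X, ?_, ?_⟩
    · rintro k (x | x)
      · exact x.elim
      · rfl
    · rintro k (x | x)
      · exact x.elim
      · rfl
  add_zero := by
    rintro ⟨X⟩
    refine mk_eq ⟨Equiv.sumEmpty X PEmpty, ?_, ?_⟩
    · rintro k (x | x)
      · rfl
      · exact x.elim
    · rintro k (x | x)
      · rfl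
      · exact x.elim
  add_comm := by
    rintro ⟨X⟩ ⟨Y⟩
    refine mk_eq ⟨Equiv.sumComm X Y, ?_, ?_⟩
    · rintro k (x | x) <;> rfl
    · rintro k (x | x) <;> rfl
  nsmul := nsmulRec

theorem mk_empty (X : ConjBiset K H) [IsEmpty X] : mk X = 0 :=
  mk_eq ⟨Equiv.equivPEmpty X, fun _ x => isEmptyElim x, fun _ x => isEmptyElim x⟩

/-- The balanced product as a biadditive operation on isomorphism classes. -/
def prodHom (K H L : Subgroup G) : BisetClass K H →+ BisetClass H L →+ BisetClass K L where
  toFun a :=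
    { toFun := fun b => Quotient.map₂ ConjBiset.prod
        (fun _ _ e _ _ f => ConjBiset.prod_congr e f) a b
      map_zero' := by
        obtain ⟨X⟩ := a
        have : IsEmpty (X.prod (ConjBiset.empty H L)) :=
          ⟨fun p => pt_ind (P := fun _ => False) (fun _ y => PEmpty.elim y) p⟩
        exact mk_empty (X.prod (ConjBiset.empty H L))
      map_add' := by
        obtain ⟨X⟩ := a
        rintro ⟨Y⟩ ⟨Y'⟩
        exact (mk_eq (ConjBiset.prod_sum X Y Y')).symm }
  map_zero' := by
    ext ⟨Y⟩
    have : IsEmpty ((ConjBiset.empty K H).prod Y) :=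
      ⟨fun p => pt_ind (P := fun _ => False) (fun x _ => PEmpty.elim x) p⟩
    exact mk_empty ((ConjBiset.empty K H).prod Y)
  map_add' := by
    rintro ⟨X⟩ ⟨X'⟩
    ext ⟨Y⟩
    exact (mk_eq (ConjBiset.sum_prod X X' Y)).symm

theorem prodHom_mk (X : ConjBiset K H) (Y : ConjBiset H L) :
    prodHom K H L (mk X) (mk Y) = mk (X.prod Y) := rfl

end BisetClass

/-! ### The category `B(G)` and its additive completion -/

open Algebra

/-- The Grothendieck group of finite bifree conjugation `K`-`H` bisets. -/
abbrev BisetGroup (K H : Subgroup G) : Type (u + 1) := GrothendieckAddGroup (BisetClass K H)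

namespace BisetGroup

variable {K H L N : Subgroup G}

/-- The class of a biset in the Grothendieck group. -/
def mk (X : ConjBiset K H) : BisetGroup K H := GrothendieckAddGroup.of (BisetClass.mk X)

theorem mk_eq {X Y : ConjBiset K H} (e : X.Iso Y) : mk X = mk Y := by
  rw [mk, mk, BisetClass.mk_eq e]

theorem mk_empty (X : ConjBiset K H) [IsEmpty X] : mk X = 0 := by
  rw [mk, BisetClass.mk_empty, map_zero]

theorem lift_mk {A : Type*} [AddCommGroup A] (f : BisetClass K H →+ A) (X : ConjBiset K H) :
    GrothendieckAddGroup.lift f (mk X) = f (BisetClass.mk X) :=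
  DFunLike.congr_fun (GrothendieckAddGroup.lift.symm_apply_apply f) (BisetClass.mk X)

theorem hom_ext {A : Type*} [AddCommGroup A] {f g : BisetGroup K H →+ A}
    (h : ∀ X, f (mk X) = g (mk X)) : f = g :=
  GrothendieckAddGroup.lift.symm.injective (by ext ⟨X⟩; exact h X)

/-- Extension of a biadditive map on isomorphism classes to Grothendieck groups. -/
def liftHom {A : Type*} [AddCommGroup A] :
    (BisetClass K H →+ A) →+ (BisetGroup K H →+ A) where
  toFun f := GrothendieckAddGroup.lift f
  map_zero' := hom_ext fun X => by simp only [lift_mk, AddMonoidHom.zero_apply]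
  map_add' f g := hom_ext fun X => by simp only [lift_mk, AddMonoidHom.add_apply]

/-- The bilinear extension of the balanced product to Grothendieck groups. -/
def prodHom (K H L : Subgroup G) : BisetGroup K H →+ BisetGroup H L →+ BisetGroup K L :=
  liftHom ((liftHom.comp (AddMonoidHom.compHom GrothendieckAddGroup.of)).comp
    (BisetClass.prodHom K H L))

theorem prodHom_mk (X : ConjBiset K H) (Y : ConjBiset H L) :
    prodHom K H L (mk X) (mk Y) = mk (X.prod Y) := by
  have h : prodHom K H L (mk X) =
      liftHom (GrothendieckAddGroup.of.comp (BisetClass.prodHom K H L (BisetClass.mk X))) :=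
    lift_mk _ X
  rw [h]
  exact lift_mk _ Y

theorem prodHom_assoc (a : BisetGroup K H) (b : BisetGroup H L) (c : BisetGroup L N) :
    prodHom K L N (prodHom K H L a b) c = prodHom K H N a (prodHom H L N b c) := by
  have key : (AddMonoidHom.compHom (prodHom K L N)).comp (prodHom K H L) =
      ((AddMonoidHom.compHom.flip (prodHom H L N)).comp
        (AddMonoidHom.compHom.comp (prodHom K H N))) := by
    refine hom_ext fun X => hom_ext fun Y => hom_ext fun Z => ?_
    simp only [AddMonoidHom.comp_apply, AddMonoidHom.compHom_apply_apply,
      AddMonoidHom.flip_apply, prodHom_mk]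
    exact mk_eq (ConjBiset.prod_assoc X Y Z)
  exact DFunLike.congr_fun (DFunLike.congr_fun (DFunLike.congr_fun key a) b) c

theorem prodHom_one_left [Finite G] (a : BisetGroup K H) :
    prodHom K K H (mk (ConjBiset.one K)) a = a := by
  have key : prodHom K K H (mk (ConjBiset.one K)) = AddMonoidHom.id _ :=
    hom_ext fun X => by rw [prodHom_mk]; exact mk_eq (ConjBiset.one_prod X)
  exact DFunLike.congr_fun key a

theorem prodHom_one_right [Finite G] (a : BisetGroup K H) :
    prodHom K H H a (mk (ConjBiset.one H)) = a := by
  have key : (prodHom K H H).flip (mk (ConjBiset.one H)) = AddMonoidHom.id _ :=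
    hom_ext fun X => by
      rw [AddMonoidHom.flip_apply, prodHom_mk]; exact mk_eq (ConjBiset.prod_one X)
  exact DFunLike.congr_fun key a

end BisetGroup

/-- The objects of the conjugation biset category `B(G)`: the subgroups of `G`. -/
structure BisetCat (G : Type u) [Group G] where
  /-- the subgroup -/
  sub : Subgroup G

/-- The category `B(G)`: a morphism `H₁ → H₂` is an element of the Grothendieck group of finite
bifree conjugation `H₂`-`H₁` bisets, and composition is the balanced product `X ∘ Y = X ×_{H₂} Y`. -/
instance [Finite G] : Category (BisetCat G) where
  Hom H₁ H₂ := BisetGroup H₂.sub H₁.sub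
  id H := BisetGroup.mk (ConjBiset.one H.sub)
  comp {H₁ H₂ H₃} Y X := BisetGroup.prodHom H₃.sub H₂.sub H₁.sub X Y
  id_comp f := BisetGroup.prodHom_one_right f
  comp_id f := BisetGroup.prodHom_one_left f
  assoc f g h := (BisetGroup.prodHom_assoc h g f).symm

instance [Finite G] (H₁ H₂ : BisetCat G) : AddCommGroup (H₁ ⟶ H₂) :=
  inferInstanceAs (AddCommGroup (BisetGroup H₂.sub H₁.sub))

theorem bisetCat_comp_def [Finite G] {H₁ H₂ H₃ : BisetCat G} (f : H₁ ⟶ H₂) (g : H₂ ⟶ H₃) :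
    f ≫ g = BisetGroup.prodHom H₃.sub H₂.sub H₁.sub g f := rfl

instance [Finite G] : Preadditive (BisetCat G) where
  add_comp H₁ H₂ H₃ f f' g := by
    simp only [bisetCat_comp_def]
    exact map_add _ _ _
  comp_add H₁ H₂ H₃ f g g' := by
    simp only [bisetCat_comp_def]
    exact (congrArg (fun a => a f) (map_add (BisetGroup.prodHom H₃.sub H₂.sub H₁.sub) g g')).trans
      (AddMonoidHom.add_apply _ _ f)

/-- The class of an `H₂`-`H₁` biset as a morphism `H₁ → H₂` of `B(G)`. -/
def bisetHom [Finite G] {H₁ H₂ : BisetCat G} (X : ConjBiset H₂.sub H₁.sub) : H₁ ⟶ H₂ :=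
  BisetGroup.mk X

theorem bisetHom_comp [Finite G] {H₁ H₂ H₃ : BisetCat G} (X : ConjBiset H₂.sub H₁.sub)
    (Y : ConjBiset H₃.sub H₂.sub) : bisetHom X ≫ bisetHom Y = bisetHom (Y.prod X) :=
  BisetGroup.prodHom_mk Y X

theorem bisetHom_eq [Finite G] {H₁ H₂ : BisetCat G} {X Y : ConjBiset H₂.sub H₁.sub}
    (e : X.Iso Y) : bisetHom X = bisetHom Y :=
  BisetGroup.mk_eq e

theorem bisetHom_empty [Finite G] {H₁ H₂ : BisetCat G} (X : ConjBiset H₂.sub H₁.sub)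
    [IsEmpty X] : bisetHom X = 0 :=
  BisetGroup.mk_empty X

/-- The additive completion `B_•(G)`: objects are finite tuples of subgroups of `G`, morphisms are
matrices of morphisms of `B(G)`. -/
abbrev BisetCatAdd (G : Type u) [Group G] [Finite G] := Mat_ (BisetCat G)

/-! ### The bivariant functor `j` -/

/-- An ordered collection of base points of a finite `G`-set, one for each orbit. -/
structure BasePoints (S : FinGSet G) where
  /-- the number of orbits -/
  num : ℕ
  /-- the base points -/
  point : Fin num → S
  exists_unique : ∀ x : S, ∃! i, x ∈ MulAction.orbit G (point i)

instance (S : FinGSet G) : Nonempty (BasePoints S) := by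
  obtain ⟨n, ⟨e⟩⟩ := Finite.exists_equiv_fin (MulAction.orbitRel.Quotient G S)
  have key : ∀ (x : S) (i : Fin n), x ∈ MulAction.orbit G (e.symm i).out ↔
      e (Quotient.mk _ x) = i := by
    intro x i
    rw [← MulAction.orbitRel_apply, ← Quotient.eq (r := MulAction.orbitRel G S), Quotient.out_eq,
      ← e.apply_eq_iff_eq, e.apply_symm_apply]
  exact ⟨⟨n, fun i => (e.symm i).out, fun x =>
    ⟨e (Quotient.mk _ x), (key x _).2 rfl, fun i hi => ((key x i).1 hi).symm⟩⟩⟩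

theorem BasePoints.eq_of_mem {S : FinGSet G} (b : BasePoints S) {x : S} {i j : Fin b.num}
    (hi : x ∈ MulAction.orbit G (b.point i)) (hj : x ∈ MulAction.orbit G (b.point j)) : i = j :=
  (b.exists_unique x).unique hi hj

/-- The object of `B_•(G)` attached to a finite `G`-set with base points `b₁, …, bₙ`: the tuple of
the stabilizers of the `bᵢ`. -/
def BasePoints.obj [Finite G] {S : FinGSet G} (b : BasePoints S) : BisetCatAdd G where
  ι := Fin b.num
  X i := ⟨MulAction.stabilizer G (b.point i)⟩

/-- For points `p`, `q` of a `G`-set, and subgroups `K`, `H` that fix `q` and `p`, the `K`-`H`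
biset `{x ∈ G | x p = q}`, with the actions by multiplication in `G`. If `q = g⁻¹ p`, then this is
the coset `K_q g⁻¹` of the stabilizer `K_q` of `q`. If `p` and `q` are in different orbits, then
it is empty. -/
def transporter [Finite G] (K H : Subgroup G) {T : Type*} [MulAction G T] (p q : T)
    (hK : K ≤ MulAction.stabilizer G q) (hH : H ≤ MulAction.stabilizer G p) : ConjBiset K H :=
  ConjBiset.ofSubset K H {x : G | x • p = q}
    (fun k hk x hx => by
      have hx : x • p = q := hx
      have h : k • q = q := hK hk
      change (k * x) • p = q
      rw [mul_smul, hx, h])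
    (fun k hk x hx => by
      have hx : x • p = q := hx
      have h : k • p = p := hH hk
      change (x * k) • p = q
      rw [mul_smul, h, hx])

/-- For `p = g q`, and `K` the stabilizer of `q`, the biset `{x | x p = q}` is isomorphic to the set
`K` with the left action of `K` by multiplication and with the right action of `H` by
`x · h = x (g⁻¹ h g)`. -/
theorem transporter_iso [Finite G] (H : Subgroup G) {T : Type*} [MulAction G T] (q : T) (g : G)
    (hH : H ≤ MulAction.stabilizer G (g • q)) :
    ∃ e : MulAction.stabilizer G q ≃
        transporter (MulAction.stabilizer G q) H (g • q) q le_rfl hH,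
      (∀ k x : MulAction.stabilizer G q, e (k * x) = k • e x) ∧
      ∀ (h : H) (x y : MulAction.stabilizer G q), (y : G) = x * (g⁻¹ * h * g) →
        e y = MulOpposite.op h • e x := by
  let f : MulAction.stabilizer G q → {x : G | x • g • q = q} := fun k =>
    ⟨k * g⁻¹, by
      change ((k : G) * g⁻¹) • g • q = q
      rw [mul_smul, inv_smul_smul]
      exact k.2⟩
  have hf : Function.Bijective f := by
    constructor
    · intro k k' h
      exact Subtype.ext (mul_right_cancel (congrArg Subtype.val h))
    · rintro ⟨x, hx⟩
      refine ⟨⟨x * g, ?_⟩, Subtype.ext (mul_inv_cancel_right x g)⟩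
      change (x * g) • q = q
      rw [mul_smul]
      exact hx
  refine ⟨Equiv.ofBijective f hf, fun k x => Subtype.ext (mul_assoc (k : G) x g⁻¹), ?_⟩
  intro h x y e
  refine Subtype.ext ?_
  change (y : G) * g⁻¹ = x * g⁻¹ * h
  rw [e]
  group

theorem stabilizer_le_map {S T : FinGSet G} (f : S ⟶ T) (x : S) :
    MulAction.stabilizer G x ≤ MulAction.stabilizer G (f x) := by
  intro g hg
  have hg : g • x = x := hg
  change g • f x = f x
  have : f (g • x) = g • f x := MulActionHom.map_smul (f : S →[G] T) g x
  rw [← this, hg]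

section j

variable [Finite G] {S T U : FinGSet G}

/-- The covariant map of `j`: the matrix of a `G`-map `f` has as entry at the base points `bᵢ` of `S`
and `cⱼ` of `T` the biset `{x | x f(bᵢ) = cⱼ}`. If `f(bᵢ) = g cⱼ`, this is isomorphic to the
biset `K` with `K = K_j` acting by multiplication and `H = H_i` through `h ↦ g⁻¹ h g`, and it is
empty, so that its class is zero, if `f(bᵢ)` is not in the orbit of `cⱼ`. -/
def jMap (b : BasePoints S) (c : BasePoints T) (f : S ⟶ T) : b.obj ⟶ c.obj :=
  fun i j => bisetHom (transporter (MulAction.stabilizer G (c.point j))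
    (MulAction.stabilizer G (b.point i)) (f (b.point i)) (c.point j) le_rfl
    (stabilizer_le_map f (b.point i)))

/-- The contravariant map of `j`: the conjugate transpose of `jMap`, with the entries
`{x | x cⱼ = f(bᵢ)}`; inversion in `G` identifies them with the entries of `jMap`, with the two
actions exchanged. -/
def jComap (b : BasePoints S) (c : BasePoints T) (f : S ⟶ T) : c.obj ⟶ b.obj :=
  fun j i => bisetHom (transporter (MulAction.stabilizer G (b.point i))
    (MulAction.stabilizer G (c.point j)) (c.point j) (f (b.point i))
    (stabilizer_le_map f (b.point i)) le_rfl)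

theorem jMap_id (b : BasePoints S) : jMap b b (𝟙 S) = 𝟙 b.obj := by
  ext i j
  by_cases h : i = j
  · subst h
    rw [Mat_.id_apply_self]
    rfl
  · rw [Mat_.id_apply_of_ne _ _ _ h]
    refine @bisetHom_empty _ _ _ _ _ _ ⟨?_⟩
    rintro ⟨x, hx⟩
    have hx : x • b.point i = b.point j := hx
    exact h (b.eq_of_mem (x := b.point j) ⟨x, hx⟩ (MulAction.mem_orbit_self _))

theorem jComap_id (b : BasePoints S) : jComap b b (𝟙 S) = 𝟙 b.obj := by
  ext i j
  by_cases h : i = j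
  · subst h
    rw [Mat_.id_apply_self]
    rfl
  · rw [Mat_.id_apply_of_ne _ _ _ h]
    refine @bisetHom_empty _ _ _ _ _ _ ⟨?_⟩
    rintro ⟨x, hx⟩
    have hx : x • b.point i = b.point j := hx
    exact h (b.eq_of_mem (x := b.point j) ⟨x, hx⟩ (MulAction.mem_orbit_self _))

theorem jMap_comp (b : BasePoints S) (c : BasePoints T) (d : BasePoints U) (f : S ⟶ T)
    (g : T ⟶ U) : jMap b d (f ≫ g) = jMap b c f ≫ jMap c d g := by
  have hg : ∀ (x : G) (t : T), g (x • t) = x • g t := fun x t =>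
    MulActionHom.map_smul (g : T →[G] U) x t
  ext i k
  obtain ⟨j, ⟨a, ha⟩, -⟩ := c.exists_unique (f (b.point i))
  have ha : a • c.point j = f (b.point i) := ha
  refine Eq.trans ?_ (Finset.sum_eq_single (s := Finset.univ)
    (f := fun j : c.obj.ι => jMap b c f i j ≫ jMap c d g j k) j ?_ ?_).symm
  · refine Eq.trans ?_ (bisetHom_comp _ _).symm
    refine (bisetHom_eq (ConjBiset.ofSubset_prod ?_ ?_ ?_)).symm
    · intro y hy x hx
      have hy : y • g (c.point j) = d.point k := hy
      have hx : x • f (b.point i) = c.point j := hx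
      change (y * x) • g (f (b.point i)) = d.point k
      rw [mul_smul, ← hg, hx, hy]
    · intro z hz
      have hz : z • g (f (b.point i)) = d.point k := hz
      refine ⟨z * a, ?_, a⁻¹, ?_, by group⟩
      · change (z * a) • g (c.point j) = d.point k
        rw [mul_smul, ← hg, ha, hz]
      · change a⁻¹ • f (b.point i) = c.point j
        rw [← ha, inv_smul_smul]
    · intro y _ y' _ x hx x' hx' e
      have hx : x • f (b.point i) = c.point j := hx
      have hx' : x' • f (b.point i) = c.point j := hx'
      have e' : y⁻¹ * y' = x * x'⁻¹ := by
        rw [inv_mul_eq_iff_eq_mul, ← mul_assoc, e, mul_inv_cancel_right]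
      change (y⁻¹ * y') • c.point j = c.point j
      rw [e', mul_smul, ← hx', inv_smul_smul, hx, hx']
  · intro j' _ hj'
    have : jMap b c f i j' = 0 := by
      refine @bisetHom_empty _ _ _ _ _ _ ⟨?_⟩
      rintro ⟨x, hx⟩
      have hx : x • f (b.point i) = c.point j' := hx
      exact hj' (c.eq_of_mem (x := f (b.point i))
        ⟨x⁻¹, by change x⁻¹ • c.point j' = _; rw [← hx, inv_smul_smul]⟩ ⟨a, ha⟩)
    rw [this, Limits.zero_comp]
  · intro h
    exact absurd (Finset.mem_univ j) h

theorem jComap_comp (b : BasePoints S) (c : BasePoints T) (d : BasePoints U) (f : S ⟶ T)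
    (g : T ⟶ U) : jComap b d (f ≫ g) = jComap c d g ≫ jComap b c f := by
  have hg : ∀ (x : G) (t : T), g (x • t) = x • g t := fun x t =>
    MulActionHom.map_smul (g : T →[G] U) x t
  ext k i
  obtain ⟨j, ⟨a, ha⟩, -⟩ := c.exists_unique (f (b.point i))
  have ha : a • c.point j = f (b.point i) := ha
  refine Eq.trans ?_ (Finset.sum_eq_single (s := Finset.univ)
    (f := fun j : c.obj.ι => jComap c d g k j ≫ jComap b c f j i) j ?_ ?_).symm
  · refine Eq.trans ?_ (bisetHom_comp _ _).symm
    refine (bisetHom_eq (ConjBiset.ofSubset_prod ?_ ?_ ?_)).symm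
    · intro y hy x hx
      have hy : y • c.point j = f (b.point i) := hy
      have hx : x • d.point k = g (c.point j) := hx
      change (y * x) • d.point k = g (f (b.point i))
      rw [mul_smul, hx, ← hg, hy]
    · intro z hz
      have hz : z • d.point k = g (f (b.point i)) := hz
      refine ⟨a, ha, a⁻¹ * z, ?_, by group⟩
      change (a⁻¹ * z) • d.point k = g (c.point j)
      rw [mul_smul, hz, ← ha, hg, inv_smul_smul]
    · intro y hy y' hy' _ _ _ _ _
      have hy : y • c.point j = f (b.point i) := hy
      have hy' : y' • c.point j = f (b.point i) := hy'
      change (y⁻¹ * y') • c.point j = c.point j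
      rw [mul_smul, hy', ← hy, inv_smul_smul]
  · intro j' _ hj'
    have : jComap b c f j' i = 0 := by
      refine @bisetHom_empty _ _ _ _ _ _ ⟨?_⟩
      rintro ⟨x, hx⟩
      exact hj' (c.eq_of_mem (x := f (b.point i)) ⟨x, hx⟩ ⟨a, ha⟩)
    rw [this, Limits.comp_zero]
  · intro h
    exact absurd (Finset.mem_univ j) h

/-- The bivariant functor `j` from finite `G`-sets to `B_•(G)`, for a choice `b` of an ordered
collection of base points of every finite `G`-set. -/
def j (b : ∀ S : FinGSet G, BasePoints S) : Bivariant (FinGSet G) (BisetCatAdd G) where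
  obj S := (b S).obj
  map {S T} f := jMap (b S) (b T) f
  comap {S T} f := jComap (b S) (b T) f
  map_id S := jMap_id (b S)
  map_comp f g := jMap_comp _ _ _ f g
  comap_id S := jComap_id (b S)
  comap_comp f g := jComap_comp _ _ _ f g

end j

end

end BisetMackey

open BisetMackey

/-!
A `K`-`H` biset is a conjugation biset precisely if it admits a labelling, that is, a map of bisets
`γ` to `G`. Such a biset `X` over `G` is the same as a span `G/H ← U → G/K` of finite `G`-sets, with
apex `U = G ×_K (X/H)` and with the legs `[a, x] ↦ a γ(x) H` and `[a, x] ↦ a K`. Everything rests on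
this dictionary.

Given a conjugation invariant Mackey functor `M`, let `X` act as `M(G/H) → M(U) → M(G/K)`. Two
labellings differ by the automorphism `[a, x] ↦ [a z(x), x]` of `U`, where `z(x)` centralizes the
stabilizer of `[1, x]`, so that conjugation invariance makes the action independent of `γ`
(`IsMackey.spanMap_congr`). The apex of a balanced product is the pullback of the apices, so that
the pullback axiom gives functoriality (`IsMackey.bisetMap_prod`), and disjoint unions of bisets go
to sums by additivity. Hence `H ↦ M(G/H)` is an additive functor on the conjugation biset category.
It extends to the additive completion, and its composite with `j` is `M` by the decomposition of
`M(S)` over the orbits of `S`: the biset `{x | x p = q}` corresponds to the pullback of two orbit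
maps (`IsMackey.bisetMap_transporter`), which gives the naturality (`IsMackey.factorization`).

For the other direction, the entries of `j^*(q)` followed by `j_*(p)` and of `j_*(f)` followed by
`j^*(g)` are computed as single bisets (`jComap_comp_jMap_apply`, `jMap_comp_jComap_apply`). The
Mackey axioms for `j`, and so for `F ∘ j`, are then bijections of bisets.

For uniqueness, the first of these computations shows that the span of a biset `X` has `X` as its
only nonzero matrix entry (`jComap_legR_comp_jMap_legL`). So the morphisms `j(S) → j(T)` are
generated by those of the form `j_*` and `j^*` (`mem_of_span_mem`). As every object of the additive
completion is isomorphic to some `j(S)`, the components `η'⁻¹ ∘ η` on the objects `j(S)` extend to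
exactly one isomorphism `F ≅ F'`.
-/

namespace BisetMackey

noncomputable section

variable {G : Type u} [Group G]

/-! ### Finite `G`-sets -/

namespace FinGSet

variable {S T U : FinGSet G}

theorem hom_smul (f : S ⟶ T) (g : G) (x : S) : f (g • x) = g • f x :=
  MulActionHom.map_smul (f : S →[G] T) g x

theorem hom_ext {f g : S ⟶ T} (h : ∀ x, f x = g x) : f = g :=
  MulActionHom.ext (f := (f : S →[G] T)) (g := g) h

/-- An equivariant function as a morphism of finite `G`-sets. -/
def ofFun (f : S → T) (h : ∀ (g : G) (x : S), f (g • x) = g • f x) : S ⟶ T :=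
  { toFun := f, map_smul' := h : S →[G] T }

/-- The map `G/H → S` with `eH ↦ x`, for a subgroup `H` of the stabilizer of `x`. -/
def orbitMap [Finite G] (H : Subgroup G) (x : S) (h : H ≤ MulAction.stabilizer G x) :
    quot H ⟶ S :=
  ofFun (S := quot H) (Quotient.lift (fun a : G => a • x) (by
    intro a a' e
    have e' : a⁻¹ * a' ∈ H := QuotientGroup.leftRel_apply.1 e
    have e'' : (a⁻¹ * a') • x = x := h e'
    change a • x = a' • x
    rw [mul_smul, inv_smul_eq_iff] at e''
    exact e''.symm)) (by
    rintro g ⟨a⟩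
    exact mul_smul g a x)

@[simp]
theorem orbitMap_mk [Finite G] (H : Subgroup G) (x : S) (h : H ≤ MulAction.stabilizer G x)
    (a : G) : orbitMap H x h (a : G ⧸ H) = a • x := rfl

theorem quot_smul_mk [Finite G] (H : Subgroup G) (a a' : G) :
    a • (show quot H from (a' : G ⧸ H)) = ((a * a' : G) : G ⧸ H) := rfl

theorem quot_hom_ext [Finite G] {H : Subgroup G} {f g : quot H ⟶ S}
    (h : f ((1 : G) : G ⧸ H) = g ((1 : G) : G ⧸ H)) : f = g := by
  refine hom_ext ?_
  rintro ⟨a⟩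
  have e : (Quot.mk _ a : quot H) = a • (show quot H from ((1 : G) : G ⧸ H)) := by
    rw [quot_smul_mk, mul_one]; rfl
  rw [e, hom_smul, hom_smul]
  exact congrArg (a • ·) h

section pullback

variable {S₁ S₂ : FinGSet G} {Ψ : S ⟶ S₁} {Φ : S ⟶ S₂} {φ : S₁ ⟶ T} {ψ : S₂ ⟶ T}

/-- A square of finite `G`-sets is a pullback as soon as it is one on underlying sets. -/
theorem isPullback_of_forall (hc : ∀ s, φ (Ψ s) = ψ (Φ s))
    (hi : ∀ s s', Ψ s = Ψ s' → Φ s = Φ s' → s = s')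
    (hs : ∀ x y, φ x = ψ y → ∃ s, Ψ s = x ∧ Φ s = y) : IsPullback Ψ Φ φ ψ := by
  choose f hf hf' using hs
  have key : ∀ (s : Limits.PullbackCone φ ψ) (x), φ (s.fst x) = ψ (s.snd x) := fun s x =>
    congrArg (fun f : s.pt ⟶ T => f x) s.condition
  refine ⟨⟨hom_ext hc⟩, ⟨Limits.PullbackCone.IsLimit.mk _
    (fun s => ofFun (fun x => f _ _ (key s x)) fun g x => hi _ _ ?_ ?_)
    (fun s => hom_ext fun x => hf _ _ (key s x)) (fun s => hom_ext fun x => hf' _ _ (key s x))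
    fun s m h₁ h₂ => hom_ext fun x => hi _ _ ?_ ?_⟩⟩
  · rw [hf, hom_smul, hom_smul, hf]
  · rw [hf', hom_smul, hom_smul, hf']
  · exact (congrArg (fun f : s.pt ⟶ S₁ => f x) h₁).trans (hf _ _ (key s x)).symm
  · exact (congrArg (fun f : s.pt ⟶ S₂ => f x) h₂).trans (hf' _ _ (key s x)).symm

/-- The points of a `G`-set `S` are the maps `G/1 → S`, so that a pullback square of finite
`G`-sets is a pullback square of sets. -/
theorem exists_of_isPullback [Finite G] (h : IsPullback Ψ Φ φ ψ) (x : S₁) (y : S₂)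
    (e : φ x = ψ y) : ∃ s, Ψ s = x ∧ Φ s = y := by
  let f := orbitMap ⊥ x bot_le
  let f' := orbitMap ⊥ y bot_le
  have hw : f ≫ φ = f' ≫ ψ := quot_hom_ext (by
    change φ ((1 : G) • x) = ψ ((1 : G) • y)
    rw [one_smul, one_smul, e])
  refine ⟨h.lift f f' hw ((1 : G) : G ⧸ (⊥ : Subgroup G)), ?_, ?_⟩
  · exact (congrArg (fun f => f ((1 : G) : G ⧸ (⊥ : Subgroup G))) (h.lift_fst f f' hw)).trans
      (one_smul G x)
  · exact (congrArg (fun f => f ((1 : G) : G ⧸ (⊥ : Subgroup G))) (h.lift_snd f f' hw)).trans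
      (one_smul G y)

/-- The uniqueness part of `exists_of_isPullback`. -/
theorem eq_of_isPullback [Finite G] (h : IsPullback Ψ Φ φ ψ) (s s' : S) (h₁ : Ψ s = Ψ s')
    (h₂ : Φ s = Φ s') : s = s' := by
  have key : orbitMap ⊥ s bot_le = orbitMap ⊥ s' bot_le := by
    refine h.hom_ext (quot_hom_ext ?_) (quot_hom_ext ?_)
    · change Ψ ((1 : G) • s) = Ψ ((1 : G) • s')
      rw [one_smul, one_smul, h₁]
    · change Φ ((1 : G) • s) = Φ ((1 : G) • s')
      rw [one_smul, one_smul, h₂]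
  have := congrArg (fun f => f ((1 : G) : G ⧸ (⊥ : Subgroup G))) key
  change (1 : G) • s = (1 : G) • s' at this
  simpa using this

end pullback

/-- A `G`-stable subset of a finite `G`-set. -/
def sub (S : FinGSet G) (A : Set S) (hA : ∀ (g : G), ∀ x ∈ A, g • x ∈ A) : FinGSet G :=
  { carrier := A
    action :=
      { smul := fun g x => ⟨g • x.1, hA g x x.2⟩
        one_smul := fun x => Subtype.ext (one_smul G x.1)
        mul_smul := fun g h x => Subtype.ext (mul_smul g h x.1) } }

/-- The inclusion of a `G`-stable subset. -/
def incl (S : FinGSet G) (A : Set S) (hA : ∀ (g : G), ∀ x ∈ A, g • x ∈ A) : S.sub A hA ⟶ S :=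
  ofFun (S := S.sub A hA) Subtype.val fun _ _ => rfl

end FinGSet

/-! ### Mackey functors and decompositions of `G`-sets -/

namespace IsMackey

open FinGSet

variable {M : Bivariant (FinGSet G) AddCommGrpCat.{w}} {S T U V : FinGSet G}

theorem map_comap_of_injective (hM : IsMackey M) (f : S ⟶ T) (hf : Function.Injective f) :
    M.map f ≫ M.comap f = 𝟙 _ := by
  have := hM.pullback (Ψ := 𝟙 S) (Φ := 𝟙 S) (φ := f) (ψ := f)
    (isPullback_of_forall (fun _ => rfl) (fun _ _ h _ => h) fun x y e => ⟨x, rfl, hf e⟩)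
  rw [this, M.comap_id, M.map_id, Category.id_comp]

/-- The pullback axiom for the square with two sides `f` and two identities: the contravariant map
of an isomorphism is inverse to its covariant map. -/
theorem comap_map_of_bijective (hM : IsMackey M) (f : S ⟶ T) (hf : Function.Bijective f) :
    M.comap f ≫ M.map f = 𝟙 _ := by
  have := hM.pullback (Ψ := f) (Φ := f) (φ := 𝟙 T) (ψ := 𝟙 T)
    (isPullback_of_forall (fun _ => rfl) (fun _ _ h _ => hf.1 h) fun x y e =>
      ⟨(hf.2 x).choose, (hf.2 x).choose_spec, (hf.2 x).choose_spec.trans e⟩)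
  rw [← this, M.comap_id, M.map_id, Category.id_comp]

theorem comap_eq_zero (hM : IsMackey M) [IsEmpty S] (f : S ⟶ T) : M.comap f = 0 := by
  have e := hM.comap_map_of_bijective (ofFun (S := FinGSet.empty G) (T := S) PEmpty.elim
    fun _ x => x.elim) ⟨fun x => PEmpty.elim x, fun x => isEmptyElim x⟩
  have := hM.empty
  have h0 : 𝟙 (M.obj (FinGSet.empty G)) = 0 := by
    ext x; exact Subsingleton.elim _ _
  have h1 : 𝟙 (M.obj S) = 0 := by
    rw [← e]
    conv_lhs => rw [← Category.id_comp (M.map _), h0]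
    simp
  rw [← Category.comp_id (M.comap f), h1, Limits.comp_zero]

theorem map_comap_of_disjoint (hM : IsMackey M) (f : S ⟶ U) (g : T ⟶ U) (h : ∀ x y, f x ≠ g y) :
    M.map f ≫ M.comap g = 0 := by
  have : IsEmpty (FinGSet.empty G) := inferInstanceAs (IsEmpty PEmpty)
  have := hM.pullback (Ψ := ofFun (S := FinGSet.empty G) (T := T) PEmpty.elim fun _ x => x.elim)
    (Φ := ofFun (S := FinGSet.empty G) (T := S) PEmpty.elim fun _ x => x.elim) (φ := g) (ψ := f)
    (isPullback_of_forall (fun x => x.elim) (fun x => x.elim) fun x y e => absurd e.symm (h y x))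
  rw [this, hM.comap_eq_zero, Limits.zero_comp]

/-- The additivity axiom, which speaks about the contravariant maps only, as a direct sum
decomposition. -/
theorem sum_decomposition (hM : IsMackey M) (S T : FinGSet G) :
    M.comap (inl S T) ≫ M.map (inl S T) + M.comap (inr S T) ≫ M.map (inr S T) =
      𝟙 (M.obj (S.sum T)) := by
  have h₁ := hM.map_comap_of_injective (inl S T) Sum.inl_injective
  have h₂ := hM.map_comap_of_injective (inr S T) Sum.inr_injective
  have h₃ := hM.map_comap_of_disjoint (inl S T) (inr S T) fun _ _ => Sum.inl_ne_inr
  have h₄ := hM.map_comap_of_disjoint (inr S T) (inl S T) fun _ _ => Sum.inr_ne_inl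
  have k₁ : (M.comap (inl S T) ≫ M.map (inl S T) + M.comap (inr S T) ≫ M.map (inr S T)) ≫
      M.comap (inl S T) = M.comap (inl S T) := by
    rw [Preadditive.add_comp, Category.assoc, Category.assoc, h₁, h₄, Category.comp_id,
      Limits.comp_zero, add_zero]
  have k₂ : (M.comap (inl S T) ≫ M.map (inl S T) + M.comap (inr S T) ≫ M.map (inr S T)) ≫
      M.comap (inr S T) = M.comap (inr S T) := by
    rw [Preadditive.add_comp, Category.assoc, Category.assoc, h₃, h₂, Category.comp_id,
      Limits.comp_zero, zero_add]
  ext x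
  exact (hM.additive S T).1 (Prod.ext (ConcreteCategory.congr_hom k₁ x)
    (ConcreteCategory.congr_hom k₂ x))

/-- The endomorphism `comap f ≫ map f` of `M(U)` is the projection onto the part of `M(U)` that
lives on the image of the injective map `f`. Here it is decomposed along a decomposition of that
image. -/
theorem comap_map_add (hM : IsMackey M) (f : S ⟶ U) (g : T ⟶ U) (h : V ⟶ U)
    (hf : Function.Injective f) (hg : Function.Injective g)
    (hh : Function.Injective h) (hd : ∀ x y, f x ≠ g y)
    (hr : Set.range h = Set.range f ∪ Set.range g) :
    M.comap h ≫ M.map h = M.comap f ≫ M.map f + M.comap g ≫ M.map g := by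
  let k : S.sum T ⟶ U := ofFun (S := S.sum T) (Sum.elim f g) (by
    rintro a (x | x)
    · exact hom_smul f a x
    · exact hom_smul g a x)
  have hk : ∀ v, ∃ x, k x = h v := by
    intro v
    have : h v ∈ Set.range f ∪ Set.range g := hr ▸ ⟨v, rfl⟩
    rcases this with ⟨x, hx⟩ | ⟨x, hx⟩
    · exact ⟨Sum.inl x, hx⟩
    · exact ⟨Sum.inr x, hx⟩
  have hk' : ∀ x, ∃ v, h v = k x := by
    rintro (x | x)
    · have : f x ∈ Set.range h := hr ▸ Or.inl ⟨x, rfl⟩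
      exact this
    · have : g x ∈ Set.range h := hr ▸ Or.inr ⟨x, rfl⟩
      exact this
  have ki : Function.Injective k := by
    rintro (x | x) (y | y) e
    · exact congrArg Sum.inl (hf e)
    · exact absurd e (hd x y)
    · exact absurd e.symm (hd y x)
    · exact congrArg Sum.inr (hg e)
  choose l hl using hk'
  let m : S.sum T ⟶ V := ofFun l fun a x => hh (by rw [hl, hom_smul, hom_smul, hl])
  have hm : m ≫ h = k := hom_ext hl
  have hb : Function.Bijective m := by
    refine ⟨fun x y e => ki ?_, fun v => ?_⟩
    · rw [← hl, ← hl]; exact congrArg h e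
    · obtain ⟨x, hx⟩ := hk v
      exact ⟨x, hh ((hl x).trans hx)⟩
  have e₁ : M.comap h ≫ M.map h = M.comap k ≫ M.map k := by
    rw [← hm, M.comap_comp, M.map_comp, Category.assoc, ← Category.assoc (M.comap m),
      hM.comap_map_of_bijective m hb, Category.id_comp]
  have e₂ : f = inl S T ≫ k := hom_ext fun _ => rfl
  have e₃ : g = inr S T ≫ k := hom_ext fun _ => rfl
  rw [e₁, e₂, e₃]
  simp only [M.comap_comp, M.map_comp, Category.assoc]
  rw [← Preadditive.comp_add, ← Category.assoc, ← Category.assoc (M.comap (inr S T)),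
    ← Preadditive.add_comp, hM.sum_decomposition, Category.id_comp]

/-- A Mackey functor turns a finite disjoint decomposition of a `G`-set into a direct sum
decomposition. -/
theorem sum_comap_map (hM : IsMackey M) {ι : Type*} [Fintype ι] {U : ι → FinGSet G}
    (f : ∀ i, U i ⟶ S) (hf : ∀ i, Function.Injective (f i)) (hd : ∀ i j x y, f i x = f j y → i = j)
    (hs : ∀ s, ∃ i x, f i x = s) :
    ∑ i, M.comap (f i) ≫ M.map (f i) = 𝟙 (M.obj S) := by
  classical
  -- Induction over the parts of the decomposition that are already joined to a subset of `S`.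
  have key : ∀ (A : Finset ι) (V : FinGSet G) (h : V ⟶ S), Function.Injective h →
      Set.range h = {s | ∃ i ∈ A, s ∈ Set.range (f i)} →
      M.comap h ≫ M.map h = ∑ i ∈ A, M.comap (f i) ≫ M.map (f i) := by
    intro A
    induction A using Finset.induction_on with
    | empty =>
      intro V h _ hr
      have : IsEmpty V := ⟨fun v => by
        have : h v ∈ {s | ∃ i ∈ (∅ : Finset ι), s ∈ Set.range (f i)} := hr ▸ ⟨v, rfl⟩
        obtain ⟨i, hi, -⟩ := this
        simp at hi⟩
      rw [hM.comap_eq_zero, Limits.zero_comp, Finset.sum_empty]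
    | insert i A hi ih =>
      intro V h hh hr
      have hA : ∀ (g : G), ∀ s ∈ {s | ∃ i ∈ A, s ∈ Set.range (f i)},
          g • s ∈ {s | ∃ i ∈ A, s ∈ Set.range (f i)} := by
        rintro g _ ⟨j, hj, x, rfl⟩
        exact ⟨j, hj, g • x, hom_smul _ _ _⟩
      have hr' : Set.range (incl S _ hA) = {s | ∃ i ∈ A, s ∈ Set.range (f i)} :=
        Subtype.range_val
      rw [Finset.sum_insert hi, ← ih _ (incl S _ hA) Subtype.val_injective hr']
      refine hM.comap_map_add _ _ _ (hf i) Subtype.val_injective hh ?_ ?_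
      · rintro x ⟨_, j, hj, y, rfl⟩ e
        exact hi (hd _ _ _ _ e ▸ hj)
      · rw [hr, hr']
        ext s
        simp
  refine (key Finset.univ S (𝟙 S) Function.injective_id ?_).symm.trans ?_
  · ext s
    obtain ⟨i, x, h⟩ := hs s
    exact ⟨fun _ => ⟨i, Finset.mem_univ i, x, h⟩, fun _ => ⟨s, rfl⟩⟩
  · rw [M.comap_id, M.map_id, Category.id_comp]

end IsMackey

/-! ### Conjugation invariance on arbitrary `G`-sets -/

/-- The maps `G/Gᵢ → S` given by the base points `bᵢ` of `S`, with the stabilizers `Gᵢ`. -/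
def BasePoints.orbit [Finite G] {S : FinGSet G} (b : BasePoints S) (i : Fin b.num) :
    FinGSet.quot (MulAction.stabilizer G (b.point i)) ⟶ S :=
  FinGSet.orbitMap _ (b.point i) le_rfl

theorem BasePoints.orbit_injective [Finite G] {S : FinGSet G} (b : BasePoints S)
    (i : Fin b.num) : Function.Injective (b.orbit i) := by
  rintro ⟨a⟩ ⟨a'⟩ e
  have e : a • b.point i = a' • b.point i := e
  refine QuotientGroup.eq.2 ?_
  change (a⁻¹ * a') • b.point i = b.point i
  rw [mul_smul, ← e, inv_smul_smul]

theorem BasePoints.orbit_eq [Finite G] {S : FinGSet G} (b : BasePoints S)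
    {i i' : Fin b.num} {x : FinGSet.quot (MulAction.stabilizer G (b.point i))}
    {x' : FinGSet.quot (MulAction.stabilizer G (b.point i'))}
    (h : b.orbit i x = b.orbit i' x') : i = i' := by
  obtain ⟨a⟩ := x
  obtain ⟨a'⟩ := x'
  exact b.eq_of_mem (x := a • b.point i) ⟨a, rfl⟩ ⟨a', h.symm⟩

theorem BasePoints.exists_orbit [Finite G] {S : FinGSet G} (b : BasePoints S) (s : S) :
    ∃ i x, b.orbit i x = s := by
  obtain ⟨i, ⟨a, ha⟩, -⟩ := b.exists_unique s
  exact ⟨i, (a : G ⧸ MulAction.stabilizer G (b.point i)), ha⟩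

namespace IsMackey

open FinGSet

variable [Finite G] {M : Bivariant (FinGSet G) AddCommGrpCat.{w}} {S : FinGSet G}

theorem sum_comap_map_orbit (hM : IsMackey M) (b : BasePoints S) :
    ∑ i, M.comap (b.orbit i) ≫ M.map (b.orbit i) = 𝟙 (M.obj S) :=
  hM.sum_comap_map b.orbit b.orbit_injective (fun _ _ _ _ => b.orbit_eq) b.exists_orbit

/-- Conjugation invariance is a condition on the covariant maps. It carries over to the
contravariant maps, because these are inverse to the covariant ones for automorphisms. -/
theorem comap_quot_eq_id (hM : IsMackey M) (hC : IsConjInvariant M) {H : Subgroup G} {z : G}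
    (hz : z ∈ Subgroup.centralizer (H : Set G)) (φ : quot H ⟶ quot H)
    (hφ : φ ((1 : G) : G ⧸ H) = ((z : G) : G ⧸ H)) : M.comap φ = 𝟙 _ := by
  have hH : ∀ w ∈ Subgroup.centralizer (H : Set G),
      H ≤ MulAction.stabilizer G (show quot H from (w : G ⧸ H)) := by
    intro w hw h hh
    change ((h * w : G) : G ⧸ H) = w
    rw [Subgroup.mem_centralizer_iff.1 hw h hh]
    exact QuotientGroup.eq.2 (by simpa using hh)
  let ψ : quot H ⟶ quot H := orbitMap H _ (hH z⁻¹ (inv_mem hz))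
  have h₁ : φ ≫ ψ = 𝟙 _ := quot_hom_ext (by
    change ψ (φ _) = _
    rw [hφ]
    change ((z * z⁻¹ : G) : G ⧸ H) = ((1 : G) : G ⧸ H)
    rw [mul_inv_cancel])
  have h₂ : M.map φ = 𝟙 _ := hC H z hz φ hφ
  have h₃ : M.map ψ = 𝟙 _ := hC H z⁻¹ (inv_mem hz) ψ (one_smul G _)
  have h₄ : ψ ≫ φ = 𝟙 _ := quot_hom_ext (by
    have e : φ = orbitMap H _ (hH z hz) := quot_hom_ext (hφ.trans (one_smul G _).symm)
    rw [e]
    change orbitMap H _ (hH z hz) ((1 * z⁻¹ : G) : G ⧸ H) = ((1 : G) : G ⧸ H)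
    change ((1 * z⁻¹ * z : G) : G ⧸ H) = ((1 : G) : G ⧸ H)
    rw [one_mul, inv_mul_cancel])
  have hb : Function.Bijective φ := Function.bijective_iff_has_inverse.2
    ⟨ψ, fun x => congrArg (fun f : quot H ⟶ quot H => f x) h₁,
      fun x => congrArg (fun f : quot H ⟶ quot H => f x) h₄⟩
  rw [← hM.comap_map_of_bijective φ hb, h₂, Category.comp_id]

/-- Conjugation invariance for an arbitrary `G`-set: a `G`-map that moves every point by an element
that centralizes the stabilizer of this point induces the identity. -/
theorem comap_eq_id (hM : IsMackey M) (hC : IsConjInvariant M) (φ : S ⟶ S)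
    (hφ : ∀ s, ∃ z ∈ Subgroup.centralizer (MulAction.stabilizer G s : Set G), φ s = z • s) :
    M.comap φ = 𝟙 _ := by
  obtain ⟨b⟩ : Nonempty (BasePoints S) := inferInstance
  have key : ∀ i, M.comap φ ≫ M.comap (b.orbit i) = M.comap (b.orbit i) := by
    intro i
    obtain ⟨z, hz, e⟩ := hφ (b.point i)
    have hH : MulAction.stabilizer G (b.point i) ≤ MulAction.stabilizer G
        (show quot (MulAction.stabilizer G (b.point i)) from
          (z : G ⧸ MulAction.stabilizer G (b.point i))) := by
      intro h hh
      change ((h * z : G) : G ⧸ MulAction.stabilizer G (b.point i)) = z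
      rw [Subgroup.mem_centralizer_iff.1 hz h hh]
      exact QuotientGroup.eq.2 (by simpa using hh)
    have e' : b.orbit i ≫ φ = orbitMap _ _ hH ≫ b.orbit i := quot_hom_ext (by
      change φ ((1 : G) • b.point i) = ((1 : G) * z) • b.point i
      rw [one_smul, one_mul, e])
    rw [← M.comap_comp, e', M.comap_comp,
      hM.comap_quot_eq_id hC hz _ (one_smul G _), Category.comp_id]
  have h := hM.sum_comap_map_orbit b
  rw [← Category.comp_id (M.comap φ), ← h, Preadditive.comp_sum]
  refine Finset.sum_congr rfl fun i _ => ?_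
  rw [← Category.assoc, key]

end IsMackey

/-! ### Bisets over `G` and their spans -/

namespace ConjBiset

open MulOpposite FinGSet

variable {K H L : Subgroup G}

/-- A morphism of bisets from `X` to `G`, where the subgroups `K` and `H` act on `G` by
multiplication. -/
structure IsLabelling (X : ConjBiset K H) (γ : X → G) : Prop where
  left : ∀ (k : K) (x : X), γ (k • x) = k * γ x
  right : ∀ (h : H) (x : X), γ (op h • x) = γ x * h

/-- The conjugation bisets are precisely the bisets over `G`: an element `g` that describes the
standard representation at `x` may be used as the image of `x`. -/
theorem exists_isLabelling (X : ConjBiset K H) : ∃ γ : X → G, X.IsLabelling γ := by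
  let r : Setoid X :=
    { r := fun x y => ∃ (k : K) (h : H), y = k • op h • x
      iseqv :=
        { refl := fun x => ⟨1, 1, by simp⟩
          symm := by
            rintro x _ ⟨k, h, rfl⟩
            refine ⟨k⁻¹, h⁻¹, ?_⟩
            rw [← X.comm, smul_smul, smul_smul, inv_mul_cancel, one_smul, ← op_mul,
              mul_inv_cancel, op_one, one_smul]
          trans := by
            rintro x _ _ ⟨k, h, rfl⟩ ⟨k', h', rfl⟩
            refine ⟨k' * k, h * h', ?_⟩
            rw [← X.comm k h', op_mul, mul_smul, mul_smul] } }
  let p : X → X := fun x => (Quotient.mk r x).out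
  have hp : ∀ x, ∃ (k : K) (h : H), x = k • op h • p x := fun x => Quotient.mk_out (s := r) x
  have hpl : ∀ (k : K) x, p (k • x) = p x := fun k x =>
    congrArg Quotient.out (Quotient.sound (s := r) (Setoid.symm' r ⟨k, 1, by simp⟩))
  have hpr : ∀ (h : H) x, p (op h • x) = p x := fun h x =>
    congrArg Quotient.out (Quotient.sound (s := r) (Setoid.symm' r ⟨1, h, by simp⟩))
  choose k h hkh using hp
  choose g hg using X.isConjugation
  -- Well-definedness of `k x h ↦ k g(x) h` for a fixed representative `x` of an orbit.
  have key : ∀ (a a' : K) (b b' : H) (x : X), a • op b • x = a' • op b' • x →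
      (a : G) * g x * b = a' * g x * b' := by
    intro a a' b b' x e
    have e' : (a'⁻¹ * a) • x = op (b' * b⁻¹) • x := by
      rw [mul_smul, inv_smul_eq_iff, op_mul, mul_smul, X.comm, ← e, ← X.comm, MulOpposite.op_inv,
        inv_smul_smul]
    have := hg x _ _ e'
    push_cast at this
    calc (a : G) * g x * b = a' * g x * ((g x)⁻¹ * ((a' : G)⁻¹ * a) * g x) * b := by group
      _ = a' * g x * b' := by rw [← this]; group
  refine ⟨fun x => k x * g (p x) * h x, fun a x => ?_, fun b x => ?_⟩
  · have e := hkh (a • x)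
    rw [hpl] at e ⊢
    rw [← mul_assoc, ← mul_assoc, ← Subgroup.coe_mul]
    refine key _ _ _ _ _ ?_
    rw [← e, mul_smul, ← hkh]
  · have e := hkh (op b • x)
    rw [hpr] at e ⊢
    rw [mul_assoc _ _ (b : G), ← Subgroup.coe_mul]
    refine key _ _ _ _ _ ?_
    rw [← e, op_mul, mul_smul, X.comm, ← hkh]

theorem IsLabelling.smul_eq {X : ConjBiset K H} {γ : X → G} (hγ : X.IsLabelling γ) (k : K) (h : H)
    (x : X) : γ (k • op h • x) = k * γ x * h := by
  rw [hγ.left, hγ.right, mul_assoc]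

section

variable (X : ConjBiset K H)

/-- The relation `(a k, x) ~ (a, k x h)` on `G × X`. -/
def apexSetoid : Setoid (G × X) where
  r p q := ∃ (k : K) (h : H), p.1 = q.1 * k ∧ q.2 = k • op h • p.2
  iseqv :=
    { refl := fun p => ⟨1, 1, by simp, by simp⟩
      symm := by
        rintro ⟨a, x⟩ ⟨b, y⟩ ⟨k, h, h₁, h₂⟩
        simp only at h₁ h₂
        refine ⟨k⁻¹, h⁻¹, ?_, ?_⟩
        · simp [h₁]
        · simp only [h₂]
          rw [← X.comm, smul_smul, smul_smul, inv_mul_cancel, one_smul, ← op_mul,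
            mul_inv_cancel, op_one, one_smul]
      trans := by
        rintro ⟨a, x⟩ ⟨b, y⟩ ⟨c, z⟩ ⟨k, h, h₁, h₂⟩ ⟨k', h', h₃, h₄⟩
        simp only at h₁ h₂ h₃ h₄
        refine ⟨k' * k, h * h', ?_, ?_⟩
        · simp [h₁, h₃, mul_assoc]
        · simp only [h₄, h₂]
          rw [← X.comm k h', op_mul, mul_smul, mul_smul] }

/-- The `G`-set `G ×_K (X / H)` attached to a `K`-`H` biset `X`. For a biset over `G` it is the
middle term of a span from `G/H` to `G/K`. -/
def apex [Finite G] : FinGSet G :=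
  { carrier := Quotient (apexSetoid X)
    action :=
      { smul := fun g => Quotient.map (fun p => (g * p.1, p.2)) (by
          rintro p q ⟨k, h, h₁, h₂⟩
          exact ⟨k, h, by simp only [h₁, mul_assoc], h₂⟩)
        one_smul := by
          rintro ⟨a, x⟩
          exact congrArg (Quotient.mk (apexSetoid X)) (Prod.ext (one_mul a) rfl)
        mul_smul := by
          rintro g g' ⟨a, x⟩
          exact congrArg (Quotient.mk (apexSetoid X)) (Prod.ext (mul_assoc g g' a) rfl) } }

variable [Finite G] {X} {Y : ConjBiset H L} {γ : X → G} {S T : FinGSet G}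

/-- The point `[a, x]` of `apex X`. -/
def apexPt (a : G) (x : X) : X.apex := Quotient.mk (apexSetoid X) (a, x)

theorem apex_ind {P : X.apex → Prop} (h : ∀ a x, P (apexPt a x)) (p : X.apex) : P p :=
  Quotient.ind (fun q => h q.1 q.2) p

theorem apexPt_eq_iff {a b : G} {x y : X} :
    apexPt a x = apexPt b y ↔ ∃ (k : K) (h : H), a = b * k ∧ y = k • op h • x :=
  Quotient.eq (r := apexSetoid X)

theorem smul_apexPt (g a : G) (x : X) : g • apexPt a x = apexPt (g * a) x := rfl

theorem apexPt_left (a : G) (k : K) (x : X) : apexPt a (k • x) = apexPt (a * k) x :=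
  (apexPt_eq_iff.2 ⟨k, 1, rfl, by simp⟩).symm

theorem apexPt_right (a : G) (h : H) (x : X) : apexPt a (op h • x) = apexPt a x :=
  (apexPt_eq_iff.2 ⟨1, h, by simp, by simp⟩).symm

/-- Maps out of `apex X`. -/
def apexLift (f : G → X → S) (hf : ∀ g a x, f (g * a) x = g • f a x)
    (hl : ∀ a (k : K) x, f a (k • x) = f (a * k) x) (hr : ∀ a (h : H) x, f a (op h • x) = f a x) :
    X.apex ⟶ S :=
  ofFun (Quotient.lift (fun p => f p.1 p.2) (by
    rintro ⟨a, x⟩ ⟨b, y⟩ ⟨k, h, h₁, h₂⟩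
    simp only at h₁ h₂
    simp only [h₁, h₂, hl, hr])) (fun g => apex_ind fun a x => hf g a x)

/-- The left leg `[a, x] ↦ a t` of the span of a biset. -/
def legL (X : ConjBiset K H) (t : T) (ht : K ≤ MulAction.stabilizer G t) : X.apex ⟶ T :=
  apexLift (fun a _ => a • t) (fun g a _ => mul_smul g a t)
    (fun a k _ => by
      have : (k : G) • t = t := ht k.2
      rw [mul_smul, this])
    fun _ _ _ => rfl

/-- The right leg `[a, x] ↦ a γ(x) s` of the span of a biset over `G`. -/
def legR (hγ : X.IsLabelling γ) (s : S) (hs : H ≤ MulAction.stabilizer G s) : X.apex ⟶ S :=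
  apexLift (fun a x => (a * γ x) • s) (fun g a x => by rw [mul_assoc, mul_smul])
    (fun a k x => by rw [hγ.left, mul_assoc])
    (fun a h x => by
      have : (h : G) • s = s := hs h.2
      rw [hγ.right, ← mul_assoc, mul_smul _ (h : G), this])

@[simp]
theorem legL_apexPt (t : T) (ht : K ≤ MulAction.stabilizer G t) (a : G) (x : X) :
    X.legL t ht (apexPt a x) = a • t := rfl

@[simp]
theorem legR_apexPt (hγ : X.IsLabelling γ) (s : S) (hs : H ≤ MulAction.stabilizer G s) (a : G)
    (x : X) : legR hγ s hs (apexPt a x) = (a * γ x) • s := rfl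

end

end ConjBiset

/-! ### The action of bisets on a conjugation invariant Mackey functor -/

namespace FinGSet

/-- The point `eH` of `G/H`. -/
def base [Finite G] (H : Subgroup G) : quot H := ((1 : G) : G ⧸ H)

theorem smul_base [Finite G] (H : Subgroup G) (a : G) : a • base H = (a : G ⧸ H) := by
  rw [base, quot_smul_mk, mul_one]

theorem smul_base_eq_iff [Finite G] {H : Subgroup G} {a b : G} :
    a • base H = b • base H ↔ a⁻¹ * b ∈ H := by
  rw [smul_base, smul_base]
  exact QuotientGroup.eq

theorem le_stabilizer_base [Finite G] (H : Subgroup G) :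
    H ≤ MulAction.stabilizer G (base H) := fun h hh => by
  change h • base H = base H
  rw [← one_smul G (base H), smul_smul, smul_base_eq_iff]
  simpa using hh

theorem exists_smul_base [Finite G] {H : Subgroup G} (x : quot H) : ∃ a : G, x = a • base H := by
  obtain ⟨a⟩ := x
  exact ⟨a, (smul_base H a).symm⟩

end FinGSet

open MulOpposite FinGSet ConjBiset

namespace Bivariant

variable [Finite G] {K H L : Subgroup G} (M : Bivariant (FinGSet G) AddCommGrpCat.{w})

/-- The map `M(G/H) → M(G/K)` of the span `G/H ← apex X → G/K` of a biset `X` over `G`. -/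
def spanMap {X : ConjBiset K H} {γ : X → G} (hγ : X.IsLabelling γ) :
    M.obj (quot H) ⟶ M.obj (quot K) :=
  M.comap (legR hγ (base H) (le_stabilizer_base H)) ≫
    M.map (X.legL (base K) (le_stabilizer_base K))

/-- The map `M(G/H) → M(G/K)` of a conjugation biset. For a conjugation invariant Mackey functor it
does not depend on the choice of a labelling. -/
def bisetMap (X : ConjBiset K H) : M.obj (quot H) ⟶ M.obj (quot K) :=
  M.spanMap X.exists_isLabelling.choose_spec

end Bivariant

namespace IsMackey

variable [Finite G] {K H L : Subgroup G} {M : Bivariant (FinGSet G) AddCommGrpCat.{w}}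

/-- Two labellings `γ`, `γ'` of a biset differ by the factors `z(x) = γ(x) γ'(x)⁻¹`, and `z(x)`
centralizes all `k` with `k x ∈ x H`. Hence the two spans differ by the automorphism
`[a, x] ↦ [a z(x), x]` of the apex, which acts as the identity on a conjugation invariant Mackey
functor. -/
theorem spanMap_congr (hM : IsMackey M) (hC : IsConjInvariant M) {X Y : ConjBiset K H}
    (e : X.Iso Y) {γ : X → G} (hγ : X.IsLabelling γ) {γ' : Y → G} (hγ' : Y.IsLabelling γ') :
    M.spanMap hγ = M.spanMap hγ' := by
  obtain ⟨e, hl, hr⟩ := e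
  let z : X → G := fun x => γ x * (γ' (e x))⁻¹
  have hz : ∀ (k : K) (h : H) x, z (k • op h • x) = k * z x * (k : G)⁻¹ := by
    intro k h x
    simp only [z, hγ.smul_eq, hl, hr, hγ'.smul_eq]
    group
  have hzl : ∀ (k : K) x, z (k • x) = k * z x * (k : G)⁻¹ := fun k x => by
    simpa using hz k 1 x
  have hzr : ∀ (h : H) x, z (op h • x) = z x := fun h x => by
    simpa using hz 1 h x
  -- The span of `(X, γ)` arises from that of `(Y, γ')` by the automorphism `φ` of the apex, applied
  -- to the right leg only, and by the isomorphism `σ` of the apices.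
  let φ : X.apex ⟶ X.apex := apexLift (fun a x => apexPt (a * z x) x)
    (fun g a x => by rw [smul_apexPt, mul_assoc])
    (fun a k x => by rw [apexPt_left, hzl]; congr 1; group)
    (fun a h x => by rw [apexPt_right, hzr])
  let σ : X.apex ⟶ Y.apex := apexLift (fun a x => apexPt a (e x))
    (fun g a x => by rw [smul_apexPt])
    (fun a k x => by rw [hl, apexPt_left])
    (fun a h x => by rw [hr, apexPt_right])
  have hσ : Function.Bijective σ := by
    constructor
    · refine apex_ind fun a x => apex_ind fun b y he => ?_
      obtain ⟨k, h, h₁, h₂⟩ := apexPt_eq_iff.1 he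
      exact apexPt_eq_iff.2 ⟨k, h, h₁, e.injective (by rw [h₂, hl, hr])⟩
    · refine apex_ind fun a y => ⟨apexPt a (e.symm y), ?_⟩
      change apexPt a (e (e.symm y)) = _
      rw [e.apply_symm_apply]
  have hφ : M.comap φ = 𝟙 _ := by
    refine hM.comap_eq_id hC φ (apex_ind fun a x => ⟨a * z x * a⁻¹, ?_, ?_⟩)
    · refine Subgroup.mem_centralizer_iff.2 fun g hg => ?_
      obtain ⟨k, h, h₁, h₂⟩ := apexPt_eq_iff.1 (show apexPt (g * a) x = apexPt a x from hg)
      have h₃ : z x = k * z x * (k : G)⁻¹ := by rw [← hz k h x, ← h₂]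
      have h₄ : g = a * k * a⁻¹ := by rw [← h₁, mul_inv_cancel_right]
      calc g * (a * z x * a⁻¹) = a * (k * z x * (k : G)⁻¹) * k * a⁻¹ := by rw [h₄]; group
        _ = a * z x * a⁻¹ * g := by rw [← h₃, h₄]; group
    · change apexPt (a * z x) x = apexPt (a * z x * a⁻¹ * a) x
      rw [inv_mul_cancel_right]
  have e₁ : legR hγ (base H) (le_stabilizer_base H) =
      φ ≫ σ ≫ legR hγ' (base H) (le_stabilizer_base H) := hom_ext (apex_ind fun a x => by
    change (a * γ x) • base H = (a * z x * γ' (e x)) • base H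
    rw [mul_assoc a, inv_mul_cancel_right])
  have e₂ : X.legL (base K) (le_stabilizer_base K) =
      σ ≫ Y.legL (base K) (le_stabilizer_base K) := hom_ext (apex_ind fun a x => rfl)
  rw [Bivariant.spanMap, Bivariant.spanMap, e₁, e₂, M.comap_comp, M.comap_comp, hφ,
    Category.comp_id, M.map_comp, Category.assoc, ← Category.assoc (M.comap σ),
    hM.comap_map_of_bijective σ hσ, Category.id_comp]

theorem bisetMap_eq_spanMap (hM : IsMackey M) (hC : IsConjInvariant M) {X : ConjBiset K H}
    {γ : X → G} (hγ : X.IsLabelling γ) : M.bisetMap X = M.spanMap hγ :=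
  hM.spanMap_congr hC (Setoid.refl' (ConjBiset.setoid K H) X) _ hγ

theorem bisetMap_congr (hM : IsMackey M) (hC : IsConjInvariant M) {X Y : ConjBiset K H}
    (e : X.Iso Y) : M.bisetMap X = M.bisetMap Y :=
  hM.spanMap_congr hC e _ _

theorem bisetMap_empty (hM : IsMackey M) : M.bisetMap (ConjBiset.empty K H) = 0 := by
  have : IsEmpty (ConjBiset.empty K H).apex :=
    ⟨fun p => apex_ind (P := fun _ => False) (fun _ x => PEmpty.elim x) p⟩
  rw [Bivariant.bisetMap, Bivariant.spanMap, hM.comap_eq_zero, Limits.zero_comp]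

theorem bisetMap_sum (hM : IsMackey M) (hC : IsConjInvariant M) (X Y : ConjBiset K H) :
    M.bisetMap (X.sum Y) = M.bisetMap X + M.bisetMap Y := by
  obtain ⟨γ, hγ⟩ := X.exists_isLabelling
  obtain ⟨γ', hγ'⟩ := Y.exists_isLabelling
  have hs : (X.sum Y).IsLabelling (Sum.elim γ γ') := by
    constructor
    · rintro k (x | x)
      · exact hγ.left k x
      · exact hγ'.left k x
    · rintro k (x | x)
      · exact hγ.right k x
      · exact hγ'.right k x
  rw [hM.bisetMap_eq_spanMap hC hγ, hM.bisetMap_eq_spanMap hC hγ',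
    hM.bisetMap_eq_spanMap hC hs]
  let i : X → X.sum Y := Sum.inl
  let j : Y → X.sum Y := Sum.inr
  let f : X.apex ⟶ (X.sum Y).apex := apexLift (fun a x => apexPt a (i x))
    (fun _ _ _ => rfl) (fun a k x => apexPt_left a k (i x)) (fun a h x => apexPt_right a h (i x))
  let g : Y.apex ⟶ (X.sum Y).apex := apexLift (fun a x => apexPt a (j x))
    (fun _ _ _ => rfl) (fun a k x => apexPt_left a k (j x)) (fun a h x => apexPt_right a h (j x))
  have key : M.comap f ≫ M.map f + M.comap g ≫ M.map g = 𝟙 _ := by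
    rw [← hM.comap_map_add f g (𝟙 _) ?_ ?_ Function.injective_id ?_ ?_, M.comap_id, M.map_id,
      Category.id_comp]
    · refine apex_ind fun a x => apex_ind fun b y he => ?_
      obtain ⟨k, h, h₁, h₂⟩ := apexPt_eq_iff.1 he
      exact apexPt_eq_iff.2 ⟨k, h, h₁, Sum.inl_injective h₂⟩
    · refine apex_ind fun a x => apex_ind fun b y he => ?_
      obtain ⟨k, h, h₁, h₂⟩ := apexPt_eq_iff.1 he
      exact apexPt_eq_iff.2 ⟨k, h, h₁, Sum.inr_injective h₂⟩
    · refine apex_ind fun a x => apex_ind fun b y he => ?_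
      obtain ⟨k, h, h₁, h₂⟩ := apexPt_eq_iff.1 he
      exact Sum.inr_ne_inl h₂
    · refine Set.ext (apex_ind ?_)
      rintro a (x | x)
      · exact ⟨fun _ => Or.inl ⟨apexPt a x, rfl⟩, fun _ => ⟨_, rfl⟩⟩
      · exact ⟨fun _ => Or.inr ⟨apexPt a x, rfl⟩, fun _ => ⟨_, rfl⟩⟩
  have e₁ : legR hγ (base H) (le_stabilizer_base H) =
      f ≫ legR hs (base H) (le_stabilizer_base H) := hom_ext (apex_ind fun a x => rfl)
  have e₂ : legR hγ' (base H) (le_stabilizer_base H) =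
      g ≫ legR hs (base H) (le_stabilizer_base H) := hom_ext (apex_ind fun a x => rfl)
  have e₃ : X.legL (base K) (le_stabilizer_base K) =
      f ≫ (X.sum Y).legL (base K) (le_stabilizer_base K) := hom_ext (apex_ind fun a x => rfl)
  have e₄ : Y.legL (base K) (le_stabilizer_base K) =
      g ≫ (X.sum Y).legL (base K) (le_stabilizer_base K) := hom_ext (apex_ind fun a x => rfl)
  simp only [Bivariant.spanMap]
  rw [e₁, e₂, e₃, e₄]
  simp only [M.comap_comp, M.map_comp, Category.assoc]
  rw [← Preadditive.comp_add, ← Category.assoc (M.comap f), ← Category.assoc (M.comap g),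
    ← Preadditive.add_comp, key, Category.id_comp]

theorem bisetMap_one (hM : IsMackey M) (hC : IsConjInvariant M) (H : Subgroup G) :
    M.bisetMap (ConjBiset.one H) = 𝟙 _ := by
  let v : ConjBiset.one H → H := fun x => x
  have hγ : (ConjBiset.one H).IsLabelling fun x => (v x : G) := ⟨fun _ _ => rfl, fun _ _ => rfl⟩
  -- Every point of the apex has the form `[a, 1]`.
  have hv : ∀ a x, (apexPt a x : (ConjBiset.one H).apex) =
      apexPt (X := ConjBiset.one H) (a * v x) (1 : H) := fun a x =>
    (congrArg (apexPt a) (show x = v x • (show ConjBiset.one H from (1 : H)) from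
      (mul_one (v x)).symm)).trans (apexPt_left a (v x) _)
  have hp := hM.pullback (Ψ := (ConjBiset.one H).legL (base H) (le_stabilizer_base H))
    (Φ := legR hγ (base H) (le_stabilizer_base H)) (φ := 𝟙 _) (ψ := 𝟙 _) (by
      refine isPullback_of_forall (apex_ind fun a x => ?_)
        (apex_ind fun a x => apex_ind fun b y h _ => ?_) fun p q e => ?_
      · change a • base H = (a * v x) • base H
        rw [smul_base_eq_iff]
        simp
      · rw [legL_apexPt, legL_apexPt, smul_base_eq_iff] at h
        rw [hv a x, hv b y]
        refine apexPt_eq_iff.2 ⟨(v y)⁻¹ * ⟨_, H.inv_mem h⟩ * v x,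
          ((v y)⁻¹ * ⟨_, H.inv_mem h⟩ * v x)⁻¹, ?_, ?_⟩
        · simp [mul_assoc]
        · exact ((mul_assoc _ _ _).symm.trans (by rw [mul_one, mul_inv_cancel] :
            ((v y)⁻¹ * ⟨_, H.inv_mem h⟩ * v x) * 1 * ((v y)⁻¹ * ⟨_, H.inv_mem h⟩ * v x)⁻¹ =
              (1 : H))).symm
      · obtain ⟨a, rfl⟩ := exists_smul_base p
        have e : a • base H = q := e
        refine ⟨apexPt (X := ConjBiset.one H) a (1 : H), rfl, ?_⟩
        change (a * (1 : H)) • base H = q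
        rw [← e, OneMemClass.coe_one, mul_one])
  rw [hM.bisetMap_eq_spanMap hC hγ, Bivariant.spanMap, ← hp, M.map_id, M.comap_id,
    Category.id_comp]

/-- The apex of a balanced product is the pullback of the apices, so that the pullback axiom turns
the balanced product into the composition of maps. -/
theorem bisetMap_prod (hM : IsMackey M) (hC : IsConjInvariant M) (X : ConjBiset K H)
    (Y : ConjBiset H L) : M.bisetMap (X.prod Y) = M.bisetMap Y ≫ M.bisetMap X := by
  obtain ⟨γ, hγ⟩ := X.exists_isLabelling
  obtain ⟨δ, hδ⟩ := Y.exists_isLabelling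
  let ε : X.prod Y → G := ptLift (fun x y => γ x * δ y) fun x h y => by
    rw [hγ.right, hδ.left, mul_assoc]
  have hε : (X.prod Y).IsLabelling ε := by
    refine ⟨fun k => pt_ind fun x y => ?_, fun l => pt_ind fun x y => ?_⟩
    · change γ (k • x) * δ y = k * (γ x * δ y)
      rw [hγ.left, mul_assoc]
    · change γ x * δ (op l • y) = γ x * δ y * l
      rw [hδ.right, mul_assoc]
  rw [hM.bisetMap_eq_spanMap hC hγ, hM.bisetMap_eq_spanMap hC hδ,
    hM.bisetMap_eq_spanMap hC hε]
  -- The projections of the apex of the product are `[a, [x, y]] ↦ [a, x]` and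
  -- `[a, [x, y]] ↦ [a γ(x), y]`.
  let Ψ : (X.prod Y).apex ⟶ X.apex := apexLift
    (fun a => ptLift (fun x _ => apexPt a x) fun x h _ => apexPt_right a h x)
    (fun g a => pt_ind fun x y => rfl)
    (fun a k => pt_ind fun x y => apexPt_left a k x)
    (fun a l => pt_ind fun x y => rfl)
  let Φ : (X.prod Y).apex ⟶ Y.apex := apexLift
    (fun a => ptLift (fun x y => apexPt (a * γ x) y) fun x h y => by
      rw [hγ.right, apexPt_left, mul_assoc])
    (fun g a => pt_ind fun x y => by
      change apexPt (g * a * γ x) y = apexPt (g * (a * γ x)) y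
      rw [mul_assoc])
    (fun a k => pt_ind fun x y => by
      change apexPt (a * γ (k • x)) y = apexPt (a * k * γ x) y
      rw [hγ.left, mul_assoc])
    (fun a l => pt_ind fun x y => apexPt_right _ l y)
  have hp := hM.pullback (Ψ := Ψ) (Φ := Φ) (φ := legR hγ (base H) (le_stabilizer_base H))
    (ψ := Y.legL (base H) (le_stabilizer_base H)) (by
      refine isPullback_of_forall (apex_ind fun a => pt_ind fun x y => rfl) ?_ ?_
      · refine apex_ind fun a => pt_ind fun x y => apex_ind fun b => pt_ind fun x' y' h₁ h₂ => ?_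
        obtain ⟨k, h, rfl, rfl⟩ := apexPt_eq_iff.1 (show apexPt a x = apexPt b x' from h₁)
        obtain ⟨h', l, h₃, rfl⟩ := apexPt_eq_iff.1
          (show apexPt (b * k * γ x) y = apexPt (b * γ (k • op h • x)) y' from h₂)
        have h₄ : h * h' = 1 := by
          rw [hγ.smul_eq, mul_assoc b, mul_assoc b, mul_right_inj, mul_assoc (k * γ x : G),
            left_eq_mul] at h₃
          exact Subtype.ext h₃
        refine apexPt_eq_iff.2 ⟨k, l, rfl, ?_⟩
        change pt (k • op h • x) (h' • op l • y) = pt (k • x) (op l • y)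
        rw [X.comm, pt_balanced, smul_smul, h₄, one_smul]
      · refine apex_ind fun a x => apex_ind fun b y e => ?_
        rw [legR_apexPt, legL_apexPt, smul_base_eq_iff] at e
        refine ⟨apexPt a (pt (X := X) (Y := Y) x ((⟨_, e⟩ : H) • y)), rfl, ?_⟩
        change apexPt (a * γ x) ((⟨_, e⟩ : H) • y) = apexPt b y
        rw [apexPt_left, mul_inv_cancel_left])
  have e₁ : legR hε (base L) (le_stabilizer_base L) =
      Φ ≫ legR hδ (base L) (le_stabilizer_base L) := hom_ext (apex_ind fun a => pt_ind fun x y => by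
    change (a * (γ x * δ y)) • base L = (a * γ x * δ y) • base L
    rw [mul_assoc])
  have e₂ : (X.prod Y).legL (base K) (le_stabilizer_base K) =
      Ψ ≫ X.legL (base K) (le_stabilizer_base K) :=
    hom_ext (apex_ind fun a => pt_ind fun x y => rfl)
  simp only [Bivariant.spanMap]
  rw [e₁, e₂, M.comap_comp, M.map_comp]
  simp only [Category.assoc]
  rw [← Category.assoc (M.comap Φ), ← hp, Category.assoc]

/-- The apex of the biset `{x | x p = q}` is the pullback of the maps `G/K → T` and `G/H → T` that
are given by the points `q` and `p`. -/
theorem bisetMap_transporter (hM : IsMackey M) (hC : IsConjInvariant M) {T : FinGSet G} (p q : T)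
    (hK : K ≤ MulAction.stabilizer G q) (hH : H ≤ MulAction.stabilizer G p) :
    M.bisetMap (transporter K H p q hK hH) =
      M.map (orbitMap H p hH) ≫ M.comap (orbitMap K q hK) := by
  let v : transporter K H p q hK hH → {x : G | x • p = q} := fun x => x
  have hv : ∀ x, (v x : G) • p = q := fun x => (v x).2
  have hγ : (transporter K H p q hK hH).IsLabelling fun x => (v x : G) :=
    ⟨fun _ _ => rfl, fun _ _ => rfl⟩
  rw [hM.bisetMap_eq_spanMap hC hγ, Bivariant.spanMap]
  refine (hM.pullback (isPullback_of_forall (apex_ind fun a x => ?_)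
    (apex_ind fun a x => apex_ind fun b y h₁ h₂ => ?_) fun r s e => ?_)).symm
  · rw [legL_apexPt, legR_apexPt, smul_base, smul_base, orbitMap_mk, orbitMap_mk, mul_smul, hv]
  · rw [legL_apexPt, legL_apexPt, eq_comm, smul_base_eq_iff] at h₁
    rw [legR_apexPt, legR_apexPt, smul_base_eq_iff] at h₂
    refine apexPt_eq_iff.2 ⟨⟨_, h₁⟩, ⟨_, h₂⟩, ?_, Subtype.ext ?_⟩
    · exact (mul_inv_cancel_left b a).symm
    · change (v y : G) = (b⁻¹ * a) * (v x * ((a * v x)⁻¹ * (b * v y)))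
      group
  · obtain ⟨a, rfl⟩ := exists_smul_base r
    obtain ⟨b, rfl⟩ := exists_smul_base s
    rw [smul_base, smul_base, orbitMap_mk, orbitMap_mk] at e
    have hx : (a⁻¹ * b) • p = q := by rw [mul_smul, ← e, inv_smul_smul]
    refine ⟨apexPt (X := transporter K H p q hK hH) a ⟨a⁻¹ * b, hx⟩, rfl, ?_⟩
    change (a * (a⁻¹ * b)) • base H = b • base H
    rw [mul_inv_cancel_left]

end IsMackey

/-! ### The additive functor of a conjugation invariant Mackey functor -/

section Mat

open Limits

variable {C : Type*} [Category C] [Preadditive C] {D : Type*} [Category D] [Preadditive D]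
  [HasFiniteBiproducts D]

/-- The extension `(X₁, …, Xₙ) ↦ F(X₁) ⊕ … ⊕ F(Xₙ)` of an additive functor to the additive
completion. This is `CategoryTheory.Mat_.lift` without its restrictions on universes. -/
def matExtend (F : C ⥤ D) [F.Additive] : Mat_ C ⥤ D where
  obj N := ⨁ fun i => F.obj (N.X i)
  map f := biproduct.matrix fun i j => F.map (f i j)
  map_id N := by
    ext i j
    by_cases h : j = i
    · subst h; simp
    · simp [biproduct.ι_π_ne _ h, Mat_.id_apply_of_ne _ _ _ h]
  map_comp f g := by
    ext i j
    simp [biproduct.lift_desc]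

instance (F : C ⥤ D) [F.Additive] : (matExtend F).Additive where
  map_add {N N'} f g := by
    change biproduct.matrix (fun i j => F.map ((f + g) i j)) =
      biproduct.matrix (fun i j => F.map (f i j)) + biproduct.matrix (fun i j => F.map (g i j))
    ext i j
    simp

theorem biproduct_matrix_comp_desc {ι κ : Type} [Fintype ι] [Fintype κ] {X : ι → D} {Y : κ → D}
    {P Q : D} {m : ∀ i k, X i ⟶ Y k} {y : ∀ k, Y k ⟶ P} {x : ∀ i, X i ⟶ Q} {f : Q ⟶ P}
    (h : ∀ i, ∑ k, m i k ≫ y k = x i ≫ f) :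
    biproduct.matrix m ≫ biproduct.desc y = biproduct.desc x ≫ f := by
  refine biproduct.hom_ext' _ _ fun i => ?_
  rw [biproduct.ι_matrix_assoc, biproduct.lift_desc, biproduct.ι_desc_assoc, h]

end Mat

namespace IsMackey

variable [Finite G] {K H L : Subgroup G} {M : Bivariant (FinGSet G) AddCommGrpCat.{w}}

/-- The additive extension of `Bivariant.bisetMap` to the Grothendieck group. -/
def groupMap (hM : IsMackey M) (hC : IsConjInvariant M) (K H : Subgroup G) :
    BisetGroup K H →+ (M.obj (quot H) ⟶ M.obj (quot K)) :=
  Algebra.GrothendieckAddGroup.lift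
    { toFun := Quotient.lift M.bisetMap fun _ _ e => hM.bisetMap_congr hC e
      map_zero' := hM.bisetMap_empty
      map_add' := by
        rintro ⟨X⟩ ⟨Y⟩
        exact hM.bisetMap_sum hC X Y }

theorem groupMap_mk (hM : IsMackey M) (hC : IsConjInvariant M) (X : ConjBiset K H) :
    hM.groupMap hC K H (BisetGroup.mk X) = M.bisetMap X :=
  BisetGroup.lift_mk _ X

/-- The order is reversed, since a `K`-`H` biset is a morphism from `H` to `K`. -/
theorem groupMap_prodHom (hM : IsMackey M) (hC : IsConjInvariant M) (a : BisetGroup K H)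
    (c : BisetGroup H L) : hM.groupMap hC K L (BisetGroup.prodHom K H L a c) =
      hM.groupMap hC H L c ≫ hM.groupMap hC K H a := by
  have h₁ : ∀ X : ConjBiset K H,
      (hM.groupMap hC K L).comp (BisetGroup.prodHom K H L (BisetGroup.mk X)) =
        (Preadditive.rightComp _ (M.bisetMap X)).comp (hM.groupMap hC H L) := fun X =>
    BisetGroup.hom_ext fun Y => by
      rw [AddMonoidHom.comp_apply, AddMonoidHom.comp_apply, BisetGroup.prodHom_mk, groupMap_mk,
        groupMap_mk, hM.bisetMap_prod hC]
      rfl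
  have h₂ : (hM.groupMap hC K L).comp ((BisetGroup.prodHom K H L).flip c) =
      (Preadditive.leftComp _ (hM.groupMap hC H L c)).comp (hM.groupMap hC K H) :=
    BisetGroup.hom_ext fun X => (DFunLike.congr_fun (h₁ X) c).trans (by
      rw [AddMonoidHom.comp_apply, AddMonoidHom.comp_apply, groupMap_mk]
      rfl)
  exact DFunLike.congr_fun h₂ a

/-- The additive functor `H ↦ M(G/H)` on the conjugation biset category that is given by a
conjugation invariant Mackey functor `M`. -/
def bisetFunctor (hM : IsMackey M) (hC : IsConjInvariant M) : BisetCat G ⥤ AddCommGrpCat.{w} where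
  obj H := M.obj (quot H.sub)
  map {H₁ H₂} f := hM.groupMap hC H₂.sub H₁.sub f
  map_id _ := (hM.groupMap_mk hC _).trans (hM.bisetMap_one hC _)
  map_comp f g := hM.groupMap_prodHom hC g f

instance (hM : IsMackey M) (hC : IsConjInvariant M) : (hM.bisetFunctor hC).Additive where
  map_add {H₁ H₂} f g := map_add (hM.groupMap hC H₂.sub H₁.sub) f g

theorem bisetFunctor_map_bisetHom (hM : IsMackey M) (hC : IsConjInvariant M) {H₁ H₂ : BisetCat G}
    (X : ConjBiset H₂.sub H₁.sub) : (hM.bisetFunctor hC).map (bisetHom X) = M.bisetMap X :=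
  hM.groupMap_mk hC X

open Limits in
/-- A Mackey functor is determined by its values on orbits: `M(S) ≅ ⨁ᵢ M(G/Gᵢ)`. -/
def orbitIso (hM : IsMackey M) {S : FinGSet G} (b : BasePoints S) :
    (⨁ fun i => M.obj (quot (MulAction.stabilizer G (b.point i)))) ≅ M.obj S where
  hom := biproduct.desc fun i => M.map (b.orbit i)
  inv := biproduct.lift fun i => M.comap (b.orbit i)
  hom_inv_id := by
    refine biproduct.hom_ext' _ _ fun i => biproduct.hom_ext _ _ fun k => ?_
    simp only [Category.assoc]
    rw [biproduct.ι_desc_assoc, biproduct.lift_π, Category.id_comp]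
    by_cases h : i = k
    · subst h
      rw [hM.map_comap_of_injective _ (b.orbit_injective i), biproduct.ι_π_self]
    · rw [hM.map_comap_of_disjoint _ _ fun x y e => h (b.orbit_eq e), biproduct.ι_π_ne _ h]
  inv_hom_id := by
    rw [biproduct.lift_desc, hM.sum_comap_map_orbit]

theorem sum_comp_comap_map_orbit (hM : IsMackey M) {S : FinGSet G} (b : BasePoints S)
    {A : AddCommGrpCat.{w}} (f : A ⟶ M.obj S) :
    ∑ i, (f ≫ M.comap (b.orbit i)) ≫ M.map (b.orbit i) = f := by
  simp only [Category.assoc]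
  rw [← Preadditive.comp_sum, hM.sum_comap_map_orbit, Category.comp_id]

open Limits in
/-- The isomorphisms `⨁ᵢ M(G/Gᵢ) ≅ M(S)` are natural, because the bisets in the matrices of `j_*(f)`
and `j^*(f)` describe the pullbacks of orbits. -/
def factorization (hM : IsMackey M) (hC : IsConjInvariant M) (b : ∀ S : FinGSet G, BasePoints S) :
    Bivariant.NatIso ((j b).postcomp (matExtend (hM.bisetFunctor hC))) M where
  app S := hM.orbitIso (b S)
  map_naturality {S T} f := by
    have h : ∀ i k, (hM.bisetFunctor hC).map (jMap (b S) (b T) f i k) =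
        (M.map ((b S).orbit i) ≫ M.map f) ≫ M.comap ((b T).orbit k) := by
      intro i k
      refine (hM.bisetFunctor_map_bisetHom hC _).trans
        ((hM.bisetMap_transporter hC _ _ _ _).trans ?_)
      rw [← M.map_comp]
      congr 2
      exact quot_hom_ext (hom_smul f _ _).symm
    refine biproduct_matrix_comp_desc fun i => (Finset.sum_congr rfl fun k _ =>
      congrArg (· ≫ M.map ((b T).orbit k)) (h i k)).trans ?_
    exact hM.sum_comp_comap_map_orbit _ _
  comap_naturality {S T} f := by
    have h : ∀ k i, (hM.bisetFunctor hC).map (jComap (b S) (b T) f k i) =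
        (M.map ((b T).orbit k) ≫ M.comap f) ≫ M.comap ((b S).orbit i) := by
      intro k i
      refine (hM.bisetFunctor_map_bisetHom hC _).trans
        ((hM.bisetMap_transporter hC _ _ _ _).trans ?_)
      rw [Category.assoc, ← M.comap_comp]
      congr 2
      exact quot_hom_ext (hom_smul f _ _).symm
    refine biproduct_matrix_comp_desc fun k => (Finset.sum_congr rfl fun i _ =>
      congrArg (· ≫ M.map ((b S).orbit i)) (h k i)).trans ?_
    exact hM.sum_comp_comap_map_orbit _ _

end IsMackey

/-! ### Matrix entries of composites in the additive completion -/

namespace ConjBiset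

variable {K H L : Subgroup G}

/-- A subset of a biset that is stable under both actions. -/
def restrict (X : ConjBiset K H) (A : Set X) (hl : ∀ (k : K), ∀ x ∈ A, k • x ∈ A)
    (hr : ∀ (h : H), ∀ x ∈ A, op h • x ∈ A) : ConjBiset K H where
  carrier := A
  left :=
    { smul := fun k x => ⟨k • x.1, hl k x x.2⟩
      one_smul := fun x => Subtype.ext (one_smul K x.1)
      mul_smul := fun k k' x => Subtype.ext (mul_smul k k' x.1) }
  right :=
    { smul := fun h x => ⟨h • x.1, hr (unop h) x x.2⟩
      one_smul := fun x => Subtype.ext (one_smul Hᵐᵒᵖ x.1)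
      mul_smul := fun k k' x => Subtype.ext (mul_smul k k' x.1) }
  comm := fun k h x => Subtype.ext (X.comm k h x.1)
  left_free := fun k x e => X.left_free k x.1 (congrArg Subtype.val e)
  right_free := fun k x e => X.right_free k x.1 (congrArg Subtype.val e)
  isConjugation := fun x => by
    obtain ⟨g, hg⟩ := X.isConjugation x.1
    exact ⟨g, fun k h e => hg k h (congrArg Subtype.val e)⟩

/-- For a span `S ← U → T` of finite `G`-sets and for points `s`, `t` fixed by `H`, `K`, the
`K`-`H` biset of all `(u, z)` such that `u` lies over `t` and `z s`. -/
def spanBiset [Finite G] (K H : Subgroup G) {S T U : FinGSet G} (q : U ⟶ S) (p : U ⟶ T) (s : S)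
    (t : T) (hK : K ≤ MulAction.stabilizer G t) (hH : H ≤ MulAction.stabilizer G s) :
    ConjBiset K H where
  carrier := {x : U × G // p x.1 = t ∧ q x.1 = x.2 • s}
  left :=
    { smul := fun k x => ⟨((k : G) • x.1.1, k * x.1.2), by
        have hk : (k : G) • t = t := hK k.2
        change p ((k : G) • x.1.1) = t ∧ q ((k : G) • x.1.1) = ((k : G) * x.1.2) • s
        rw [hom_smul, hom_smul, x.2.1, x.2.2, mul_smul]
        exact ⟨hk, rfl⟩⟩
      one_smul := fun x => Subtype.ext (Prod.ext (one_smul G x.1.1) (one_mul x.1.2))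
      mul_smul := fun k k' x => Subtype.ext
        (Prod.ext (mul_smul (k : G) (k' : G) x.1.1) (mul_assoc (k : G) k' x.1.2)) }
  right :=
    { smul := fun h x => ⟨(x.1.1, x.1.2 * (unop h : H)), by
        have hh : ((unop h : H) : G) • s = s := hH (unop h).2
        refine ⟨x.2.1, ?_⟩
        change q x.1.1 = (x.1.2 * (unop h : H)) • s
        rw [mul_smul, hh, x.2.2]⟩
      one_smul := fun x => Subtype.ext (Prod.ext rfl (mul_one x.1.2))
      mul_smul := fun h h' x => Subtype.ext
        (Prod.ext rfl (mul_assoc x.1.2 (unop h' : H) (unop h : H)).symm) }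
  comm := fun k h x => Subtype.ext (Prod.ext rfl (mul_assoc (k : G) x.1.2 h).symm)
  left_free := fun k x e => by
    have e' : (k : G) * x.1.2 = x.1.2 := congrArg (fun x => x.1.2) e
    exact Subtype.ext (by simpa using e')
  right_free := fun h x e => by
    have e' : x.1.2 * (h : G) = x.1.2 := congrArg (fun x => x.1.2) e
    exact Subtype.ext (by simpa using e')
  isConjugation := fun x => ⟨x.1.2, fun k h e => by
    have e' : (k : G) * x.1.2 = x.1.2 * h := congrArg (fun x => x.1.2) e
    rw [mul_assoc, e', inv_mul_cancel_left]⟩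

/-- A finite decomposition of a biset is a sum in the Grothendieck group. -/
theorem mk_eq_sum {ι : Type*} [Fintype ι] (X : ConjBiset K H) (Y : ι → ConjBiset K H)
    (f : ∀ i, Y i → X) (hl : ∀ i (k : K) y, f i (k • y) = k • f i y)
    (hr : ∀ i (h : H) y, f i (op h • y) = op h • f i y) (hi : ∀ i, Function.Injective (f i))
    (hd : ∀ i j y y', f i y = f j y' → i = j) (hs : ∀ x, ∃ i y, f i y = x) :
    BisetGroup.mk X = ∑ i, BisetGroup.mk (Y i) := by
  classical
  -- Induction over the parts that are already joined to a subset of `X`.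
  have key : ∀ (A : Finset ι) (hA hA'),
      BisetGroup.mk (X.restrict {x | ∃ i ∈ A, x ∈ Set.range (f i)} hA hA') =
        ∑ i ∈ A, BisetGroup.mk (Y i) := by
    intro A
    induction A using Finset.induction_on with
    | empty =>
      intro hA hA'
      have : IsEmpty (X.restrict {x | ∃ i ∈ (∅ : Finset ι), x ∈ Set.range (f i)} hA hA') :=
        ⟨fun x => by
          obtain ⟨i, hi, -⟩ := x.2
          simp at hi⟩
      rw [BisetGroup.mk_empty, Finset.sum_empty]
    | insert i A hiA ih =>
      intro hA hA'
      have hB : ∀ (k : K), ∀ x ∈ {x | ∃ i ∈ A, x ∈ Set.range (f i)},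
          k • x ∈ {x | ∃ i ∈ A, x ∈ Set.range (f i)} := by
        rintro k _ ⟨j, hj, y, rfl⟩
        exact ⟨j, hj, k • y, hl j k y⟩
      have hB' : ∀ (h : H), ∀ x ∈ {x | ∃ i ∈ A, x ∈ Set.range (f i)},
          op h • x ∈ {x | ∃ i ∈ A, x ∈ Set.range (f i)} := by
        rintro h _ ⟨j, hj, y, rfl⟩
        exact ⟨j, hj, op h • y, hr j h y⟩
      rw [Finset.sum_insert hiA, ← ih hB hB', BisetGroup.mk, BisetGroup.mk, BisetGroup.mk,
        ← map_add]
      refine congrArg _ (BisetClass.mk_eq (Setoid.symm' (ConjBiset.setoid K H)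
        (Iso.of_bijective (X := (Y i).sum (X.restrict _ hB hB'))
        (Sum.elim (fun y => ⟨f i y, i, Finset.mem_insert_self i A, y, rfl⟩) fun x =>
          ⟨x.1, x.2.choose, Finset.mem_insert_of_mem x.2.choose_spec.1, x.2.choose_spec.2⟩)
        ⟨?_, ?_⟩ ?_ ?_)))
      · rintro (y | ⟨_, j, hj, y, rfl⟩) (y' | ⟨_, j', hj', y', rfl⟩) e
        · exact congrArg Sum.inl (hi i (congrArg Subtype.val e))
        · exact absurd (hd _ _ _ _ (congrArg Subtype.val e)) fun h => hiA (h ▸ hj')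
        · exact absurd (hd _ _ _ _ (congrArg Subtype.val e)) fun h => hiA (h ▸ hj)
        · exact congrArg Sum.inr (Subtype.ext (congrArg Subtype.val e :))
      · rintro ⟨_, j, hj, y, rfl⟩
        rcases Finset.mem_insert.1 hj with rfl | hj'
        · exact ⟨Sum.inl y, rfl⟩
        · exact ⟨Sum.inr ⟨f j y, j, hj', y, rfl⟩, rfl⟩
      · rintro k (y | x)
        · exact Subtype.ext (hl i k y)
        · rfl
      · rintro h (y | x)
        · exact Subtype.ext (hr i h y)
        · rfl
  have hall : ∀ x, ∃ i ∈ Finset.univ, x ∈ Set.range (f i) := fun x => by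
    obtain ⟨i, y, h⟩ := hs x
    exact ⟨i, Finset.mem_univ i, y, h⟩
  rw [← key Finset.univ (fun _ _ _ => hall _) (fun _ _ _ => hall _)]
  refine BisetGroup.mk_eq (Iso.of_bijective (fun x => ⟨x, hall x⟩)
    ⟨fun x y e => congrArg Subtype.val e, fun x => ⟨x.1, rfl⟩⟩ (fun _ _ => rfl) fun _ _ => rfl)

end ConjBiset

section Transporter

variable [Finite G] {K H : Subgroup G} {T : Type*} [MulAction G T] {p q : T}
  {hK : K ≤ MulAction.stabilizer G q} {hH : H ≤ MulAction.stabilizer G p}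

/-- An element of `{x | x p = q}` as an element of `G`. -/
def transporterVal (x : transporter K H p q hK hH) : G := (show {x : G | x • p = q} from x).1

theorem transporterVal_smul (x : transporter K H p q hK hH) : transporterVal x • p = q :=
  (show {x : G | x • p = q} from x).2

theorem transporterVal_injective :
    Function.Injective (transporterVal : transporter K H p q hK hH → G) :=
  Subtype.val_injective

theorem exists_transporterVal_eq (x : G) (hx : x • p = q) :
    ∃ y : transporter K H p q hK hH, transporterVal y = x := ⟨⟨x, hx⟩, rfl⟩

end Transporter

section Matrices

variable [Finite G] {S T U S' : FinGSet G}

/-- The entries of `j^*(q)` followed by `j_*(p)`, for a span `S ← U → T`. The summand of a base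
point `d` of `U` consists of the `(u, z)` with `u` in the orbit of `d`, by `[y, x] ↦ (y d, y x)`. -/
theorem jComap_comp_jMap_apply (b : BasePoints S) (c : BasePoints T) (d : BasePoints U)
    (q : U ⟶ S) (p : U ⟶ T) (i : Fin b.num) (k : Fin c.num) :
    (jComap d b q ≫ jMap d c p) i k =
      bisetHom (spanBiset (MulAction.stabilizer G (c.point k)) (MulAction.stabilizer G (b.point i))
        q p (b.point i) (c.point k) le_rfl le_rfl) := by
  let A : ∀ l : Fin d.num, ConjBiset (c.obj.X k).sub (d.obj.X l).sub := fun l =>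
    transporter (MulAction.stabilizer G (c.point k)) (MulAction.stabilizer G (d.point l))
      (p (d.point l)) (c.point k) le_rfl (stabilizer_le_map p _)
  let B : ∀ l : Fin d.num, ConjBiset (d.obj.X l).sub (b.obj.X i).sub := fun l =>
    transporter (MulAction.stabilizer G (d.point l)) (MulAction.stabilizer G (b.point i))
      (b.point i) (q (d.point l)) (stabilizer_le_map q _) le_rfl
  let v : ∀ l, A l → G := fun l => transporterVal
  let w : ∀ l, B l → G := fun l => transporterVal
  have hv : ∀ l y, v l y • p (d.point l) = c.point k := fun l => transporterVal_smul
  have hw : ∀ l x, w l x • b.point i = q (d.point l) := fun l => transporterVal_smul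
  have e : (jComap d b q ≫ jMap d c p) i k = ∑ l : d.obj.ι, bisetHom ((A l).prod (B l)) :=
    (Mat_.comp_apply (jComap d b q) (jMap d c p) i k).trans
      (Finset.sum_congr rfl fun l _ => bisetHom_comp (B l) (A l))
  rw [e]
  let X := spanBiset (MulAction.stabilizer G (c.point k)) (MulAction.stabilizer G (b.point i))
    q p (b.point i) (c.point k) le_rfl le_rfl
  let f : ∀ l, (A l).prod (B l) → X := fun l =>
    ptLift (fun y x => ⟨(v l y • d.point l, v l y * w l x), by
      rw [hom_smul, hom_smul, mul_smul, hw, hv]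
      exact ⟨rfl, rfl⟩⟩) fun y h x => by
        have hh : (h : G) • d.point l = d.point l := h.2
        refine Subtype.ext (Prod.ext ?_ (mul_assoc (v l y) (h : G) (w l x)))
        change (v l y * h) • d.point l = v l y • d.point l
        rw [mul_smul, hh]
  refine (mk_eq_sum X _ f ?_ ?_ ?_ ?_ ?_).symm
  · exact fun l k => pt_ind fun y x => Subtype.ext
      (Prod.ext (mul_smul (k : G) (v l y) (d.point l)) (mul_assoc (k : G) (v l y) (w l x)))
  · exact fun l h => pt_ind fun y x => Subtype.ext
      (Prod.ext rfl (mul_assoc (v l y) (w l x) (h : G)).symm)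
  · refine fun l => pt_ind fun y x => pt_ind fun y' x' e => ?_
    have e₁ : v l y • d.point l = v l y' • d.point l := congrArg (fun x => x.1.1) e
    have e₂ : v l y * w l x = v l y' * w l x' := congrArg (fun x => x.1.2) e
    have hm : (v l y)⁻¹ * v l y' ∈ (d.obj.X l).sub := by
      change ((v l y)⁻¹ * v l y') • d.point l = d.point l
      rw [mul_smul, ← e₁, inv_smul_smul]
    refine pt_eq_iff.2 ⟨⟨_, hm⟩, transporterVal_injective ?_, transporterVal_injective ?_⟩
    · exact (mul_inv_cancel_left (v l y) (v l y')).symm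
    · change w l x = (v l y)⁻¹ * v l y' * w l x'
      rw [mul_assoc, ← e₂, inv_mul_cancel_left]
  · intro l l' r r' e
    obtain ⟨y, x, rfl⟩ := pt_surj r
    obtain ⟨y', x', rfl⟩ := pt_surj r'
    have e₁ : v l y • d.point l = v l' y' • d.point l' := congrArg (fun x => x.1.1) e
    exact d.eq_of_mem (x := v l y • d.point l) ⟨v l y, rfl⟩ ⟨v l' y', e₁.symm⟩
  · rintro ⟨⟨u, z⟩, hp, hq⟩
    obtain ⟨l, ⟨a, rfl⟩, -⟩ := d.exists_unique u
    have hp : p (a • d.point l) = c.point k := hp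
    have hq : q (a • d.point l) = z • b.point i := hq
    rw [hom_smul] at hp hq
    obtain ⟨y, hy⟩ : ∃ y, v l y = a := exists_transporterVal_eq a hp
    obtain ⟨x, hx⟩ : ∃ x, w l x = a⁻¹ * z := exists_transporterVal_eq (a⁻¹ * z) (by
      rw [mul_smul, ← hq, inv_smul_smul])
    refine ⟨l, pt y x, Subtype.ext (Prod.ext ?_ ?_)⟩
    · exact congrArg (· • d.point l) hy
    · change v l y * w l x = z
      rw [hy, hx, mul_inv_cancel_left]

/-- The entries of `j_*(f)` followed by `j^*(g)`, for a cospan `S → T ← S'`. Only the base point of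
`T` in the orbit of `g(b'ₖ)` contributes. -/
theorem jMap_comp_jComap_apply (b : BasePoints S) (b' : BasePoints S') (c : BasePoints T)
    (f : S ⟶ T) (g : S' ⟶ T) (i : Fin b.num) (k : Fin b'.num) :
    (jMap b c f ≫ jComap b' c g) i k =
      bisetHom (transporter (MulAction.stabilizer G (b'.point k))
        (MulAction.stabilizer G (b.point i)) (f (b.point i)) (g (b'.point k))
        (stabilizer_le_map g _) (stabilizer_le_map f _)) := by
  let A : ∀ l : Fin c.num, ConjBiset (b'.obj.X k).sub (c.obj.X l).sub := fun l =>
    transporter (MulAction.stabilizer G (b'.point k)) (MulAction.stabilizer G (c.point l))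
      (c.point l) (g (b'.point k)) (stabilizer_le_map g _) le_rfl
  let B : ∀ l : Fin c.num, ConjBiset (c.obj.X l).sub (b.obj.X i).sub := fun l =>
    transporter (MulAction.stabilizer G (c.point l)) (MulAction.stabilizer G (b.point i))
      (f (b.point i)) (c.point l) le_rfl (stabilizer_le_map f _)
  let v : ∀ l, A l → G := fun l => transporterVal
  let w : ∀ l, B l → G := fun l => transporterVal
  have hv : ∀ l y, v l y • c.point l = g (b'.point k) := fun l => transporterVal_smul
  have hw : ∀ l x, w l x • f (b.point i) = c.point l := fun l => transporterVal_smul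
  have e : (jMap b c f ≫ jComap b' c g) i k = ∑ l : c.obj.ι, bisetHom ((A l).prod (B l)) :=
    (Mat_.comp_apply (jMap b c f) (jComap b' c g) i k).trans
      (Finset.sum_congr rfl fun l _ => bisetHom_comp (B l) (A l))
  rw [e]
  let X := transporter (MulAction.stabilizer G (b'.point k))
    (MulAction.stabilizer G (b.point i)) (f (b.point i)) (g (b'.point k))
    (stabilizer_le_map g _) (stabilizer_le_map f _)
  let φ : ∀ l, (A l).prod (B l) → X := fun l =>
    ptLift (fun y x => ⟨v l y * w l x, by
      change (v l y * w l x) • f (b.point i) = g (b'.point k)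
      rw [mul_smul, hw, hv]⟩) fun y h x => Subtype.ext (mul_assoc (v l y) (h : G) (w l x))
  refine (mk_eq_sum X _ φ ?_ ?_ ?_ ?_ ?_).symm
  · exact fun l k => pt_ind fun y x => Subtype.ext (mul_assoc (k : G) (v l y) (w l x))
  · exact fun l h => pt_ind fun y x => Subtype.ext (mul_assoc (v l y) (w l x) (h : G)).symm
  · refine fun l => pt_ind fun y x => pt_ind fun y' x' e => ?_
    have e : v l y * w l x = v l y' * w l x' := congrArg Subtype.val e
    have hm : (v l y)⁻¹ * v l y' ∈ (c.obj.X l).sub := by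
      change ((v l y)⁻¹ * v l y') • c.point l = c.point l
      rw [mul_smul, hv, ← hv l y, inv_smul_smul]
    refine pt_eq_iff.2 ⟨⟨_, hm⟩, transporterVal_injective ?_, transporterVal_injective ?_⟩
    · exact (mul_inv_cancel_left (v l y) (v l y')).symm
    · change w l x = (v l y)⁻¹ * v l y' * w l x'
      rw [mul_assoc, ← e, inv_mul_cancel_left]
  · intro l l' r r' _
    obtain ⟨y, x, rfl⟩ := pt_surj r
    obtain ⟨y', x', rfl⟩ := pt_surj r'
    exact c.eq_of_mem (x := g (b'.point k)) ⟨v l y, hv l y⟩ ⟨v l' y', hv l' y'⟩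
  · rintro ⟨z, hz⟩
    have hz : z • f (b.point i) = g (b'.point k) := hz
    obtain ⟨l, ⟨a, ha⟩, -⟩ := c.exists_unique (g (b'.point k))
    have ha : a • c.point l = g (b'.point k) := ha
    obtain ⟨y, hy⟩ : ∃ y, v l y = a := exists_transporterVal_eq a ha
    obtain ⟨x, hx⟩ : ∃ x, w l x = a⁻¹ * z := exists_transporterVal_eq (a⁻¹ * z) (by
      rw [mul_smul, hz, ← ha, inv_smul_smul])
    refine ⟨l, pt y x, Subtype.ext ?_⟩
    change v l y * w l x = z
    rw [hy, hx, mul_inv_cancel_left]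

end Matrices

/-! ### Additive functors give conjugation invariant Mackey functors -/

section Axioms

variable [Finite G] {S T U S₁ S₂ : FinGSet G}

/-- The pullback axiom for `j`. Both sides have the entries `{z | z ψ(b₂) = φ(b₁)}`: in the biset of
the span `S₂ ← S → S₁` the point `u` of a pair `(u, z)` is the one over `b₁` and `z b₂`. -/
theorem jMap_comp_jComap_of_isPullback {Ψ : S ⟶ S₁} {Φ : S ⟶ S₂} {φ : S₁ ⟶ T} {ψ : S₂ ⟶ T}
    (h : IsPullback Ψ Φ φ ψ) (b : BasePoints S) (b₁ : BasePoints S₁) (b₂ : BasePoints S₂)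
    (c : BasePoints T) :
    jMap b₂ c ψ ≫ jComap b₁ c φ = jComap b b₂ Φ ≫ jMap b b₁ Ψ := by
  ext i k
  have hw : ∀ s, φ (Ψ s) = ψ (Φ s) := fun s => congrArg (fun f : S ⟶ T => f s) h.w
  refine (jMap_comp_jComap_apply b₂ b₁ c ψ φ i k).trans (Eq.trans ?_
    (jComap_comp_jMap_apply b₂ b₁ b Φ Ψ i k).symm)
  let A := spanBiset (MulAction.stabilizer G (b₁.point k)) (MulAction.stabilizer G (b₂.point i))
    Φ Ψ (b₂.point i) (b₁.point k) le_rfl le_rfl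
  let B := transporter (MulAction.stabilizer G (b₁.point k)) (MulAction.stabilizer G (b₂.point i))
    (ψ (b₂.point i)) (φ (b₁.point k)) (stabilizer_le_map φ _) (stabilizer_le_map ψ _)
  refine (bisetHom_eq (Iso.of_bijective (X := A) (Y := B) (fun x => ⟨x.1.2, ?_⟩) ⟨?_, ?_⟩
    (fun k x => rfl) fun h x => rfl)).symm
  · change x.1.2 • ψ (b₂.point i) = φ (b₁.point k)
    exact (hom_smul ψ _ _).symm.trans ((congrArg ψ x.2.2.symm).trans
      ((hw _).symm.trans (congrArg φ x.2.1)))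
  · rintro ⟨⟨u, z⟩, hp, hq⟩ ⟨⟨u', z'⟩, hp', hq'⟩ e
    obtain rfl : z = z' := congrArg Subtype.val e
    exact Subtype.ext (Prod.ext (eq_of_isPullback h _ _ (hp.trans hp'.symm) (hq.trans hq'.symm))
      rfl)
  · rintro ⟨z, hz⟩
    have hz : z • ψ (b₂.point i) = φ (b₁.point k) := hz
    obtain ⟨u, h₁, h₂⟩ := exists_of_isPullback h (b₁.point k) (z • b₂.point i)
      (by rw [hom_smul, hz])
    exact ⟨⟨(u, z), h₁, h₂⟩, rfl⟩

theorem jMap_comp_jComap_of_injective (b : BasePoints S) (c : BasePoints T) (f : S ⟶ T)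
    (hf : Function.Injective f) : jMap b c f ≫ jComap b c f = 𝟙 b.obj := by
  rw [jMap_comp_jComap_of_isPullback (Ψ := 𝟙 S) (Φ := 𝟙 S)
    (isPullback_of_forall (fun _ => rfl) (fun _ _ h _ => h) fun x y e => ⟨x, rfl, hf e⟩)
    b b b c, jMap_id, jComap_id, Category.id_comp]

theorem jMap_comp_jComap_of_disjoint (b : BasePoints S) (b' : BasePoints T) (c : BasePoints U)
    (f : S ⟶ U) (g : T ⟶ U) (h : ∀ x y, f x ≠ g y) : jMap b c f ≫ jComap b' c g = 0 := by
  ext i k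
  refine (jMap_comp_jComap_apply b b' c f g i k).trans (@bisetHom_empty _ _ _ _ _ _ ⟨fun x => ?_⟩)
  have hx : transporterVal x • f (b.point i) = g (b'.point k) := transporterVal_smul x
  rw [← hom_smul] at hx
  exact h _ _ hx

theorem id_apply_eq (b : BasePoints S) (i k : Fin b.num) : (𝟙 b.obj : b.obj ⟶ b.obj) i k =
    bisetHom (transporter (MulAction.stabilizer G (b.point k)) (MulAction.stabilizer G (b.point i))
      (b.point i) (b.point k) le_rfl le_rfl) := by
  rw [← jMap_id]
  rfl

/-- The counterpart of `IsMackey.sum_comap_map` for `j`: in a decomposition of `S`, exactly one part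
contains a given base point. -/
theorem sum_jComap_comp_jMap {ι : Type*} [Fintype ι] {U : ι → FinGSet G}
    (d : ∀ l, BasePoints (U l)) (b : BasePoints S) (f : ∀ l, U l ⟶ S)
    (hf : ∀ l, Function.Injective (f l)) (hd : ∀ l l' x y, f l x = f l' y → l = l')
    (hs : ∀ s, ∃ l x, f l x = s) : ∑ l, jComap (d l) b (f l) ≫ jMap (d l) b (f l) = 𝟙 b.obj := by
  ext i k
  let A : ι → ConjBiset (b.obj.X k).sub (b.obj.X i).sub := fun l => spanBiset
    (MulAction.stabilizer G (b.point k)) (MulAction.stabilizer G (b.point i))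
    (f l) (f l) (b.point i) (b.point k) le_rfl le_rfl
  have e₁ : (∑ l, jComap (d l) b (f l) ≫ jMap (d l) b (f l)) i k =
      ∑ l, (jComap (d l) b (f l) ≫ jMap (d l) b (f l)) i k := by
    let ev : (b.obj ⟶ b.obj) →+ (b.obj.X i ⟶ b.obj.X k) :=
      { toFun := fun m => m i k, map_zero' := rfl, map_add' := fun _ _ => rfl }
    exact map_sum ev _ _
  have e₂ : ∑ l, (jComap (d l) b (f l) ≫ jMap (d l) b (f l)) i k = ∑ l, bisetHom (A l) :=
    Finset.sum_congr rfl fun l _ => jComap_comp_jMap_apply b b (d l) (f l) (f l) i k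
  refine e₁.trans (e₂.trans (Eq.trans ?_ (id_apply_eq b i k).symm))
  let B := transporter (MulAction.stabilizer G (b.point k)) (MulAction.stabilizer G (b.point i))
    (b.point i) (b.point k) le_rfl le_rfl
  refine (mk_eq_sum B A (fun l x => ⟨x.1.2, ?_⟩) (fun l k x => rfl) (fun l h x => rfl)
    ?_ ?_ ?_).symm
  · exact x.2.2.symm.trans x.2.1
  · rintro l ⟨⟨u, z⟩, hp, hq⟩ ⟨⟨u', z'⟩, hp', hq'⟩ e
    obtain rfl : z = z' := congrArg Subtype.val e
    exact Subtype.ext (Prod.ext (hf l (hp.trans hp'.symm)) rfl)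
  · rintro l l' ⟨⟨u, z⟩, hp, hq⟩ ⟨⟨u', z'⟩, hp', hq'⟩ e
    exact hd l l' u u' (hp.trans hp'.symm)
  · rintro ⟨z, hz⟩
    have hz : z • b.point i = b.point k := hz
    obtain ⟨l, u, hu⟩ := hs (b.point k)
    exact ⟨l, ⟨(u, z), hu, hu.trans hz.symm⟩, rfl⟩

/-- If `φ(bᵢ) = z bᵢ` and `z` centralizes the stabilizer of `bᵢ`, then `x ↦ x z` is an isomorphism
from the entry `{x | x φ(bᵢ) = bₖ}` of `j_*(φ)` to that of the identity. -/
theorem jMap_eq_id (b : BasePoints S) (φ : S ⟶ S)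
    (hφ : ∀ s, ∃ z ∈ Subgroup.centralizer (MulAction.stabilizer G s : Set G), φ s = z • s) :
    jMap b b φ = 𝟙 b.obj := by
  ext i k
  refine Eq.trans ?_ (id_apply_eq b i k).symm
  obtain ⟨z, hz, e⟩ := hφ (b.point i)
  refine bisetHom_eq (Iso.of_bijective (fun x => ⟨transporterVal x * z, ?_⟩) ⟨?_, ?_⟩ ?_ ?_)
  · change (transporterVal x * z) • b.point i = b.point k
    rw [mul_smul, ← e]
    exact transporterVal_smul x
  · intro x y h
    exact transporterVal_injective (mul_right_cancel (congrArg Subtype.val h))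
  · rintro ⟨y, hy⟩
    have hy : y • b.point i = b.point k := hy
    obtain ⟨x, hx⟩ := exists_transporterVal_eq
      (hK := le_refl (MulAction.stabilizer G (b.point k))) (hH := stabilizer_le_map φ (b.point i))
      (y * z⁻¹) (show (y * z⁻¹) • φ (b.point i) = b.point k by
        rw [e, smul_smul, inv_mul_cancel_right, hy])
    exact ⟨x, Subtype.ext (show transporterVal x * z = y by rw [hx, inv_mul_cancel_right])⟩
  · exact fun k x => Subtype.ext (mul_assoc (k : G) (transporterVal x) z)
  · intro h x
    refine Subtype.ext ?_
    change transporterVal x * h * z = transporterVal x * z * h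
    rw [mul_assoc, mul_assoc, Subgroup.mem_centralizer_iff.1 hz h h.2]

theorem isConjInvariant_postcomp (b : ∀ S : FinGSet G, BasePoints S)
    (F : BisetCatAdd G ⥤ AddCommGrpCat.{w}) : IsConjInvariant ((j b).postcomp F) := by
  intro H z hz φ hφ
  have h : jMap (b (quot H)) (b (quot H)) φ = 𝟙 _ := by
    refine jMap_eq_id _ φ fun s => ?_
    obtain ⟨a, rfl⟩ := exists_smul_base s
    refine ⟨a * z * a⁻¹, Subgroup.mem_centralizer_iff.2 fun g hg => ?_, ?_⟩
    · have hg' : (g * a) • base H = a • base H := (mul_smul g a (base H)).trans hg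
      have hm := smul_base_eq_iff.1 hg'
      have hc := Subgroup.mem_centralizer_iff.1 hz _ (H.inv_mem hm)
      have : g = a * ((g * a)⁻¹ * a)⁻¹ * a⁻¹ := by group
      calc g * (a * z * a⁻¹) = a * (((g * a)⁻¹ * a)⁻¹ * z) * a⁻¹ := by group
        _ = a * (z * ((g * a)⁻¹ * a)⁻¹) * a⁻¹ := by rw [hc]
        _ = a * z * a⁻¹ * g := by group
    · have hφ' : φ (base H) = z • base H := hφ.trans (smul_base H z).symm
      rw [hom_smul, hφ', smul_smul, smul_smul, inv_mul_cancel_right]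
  exact (congrArg F.map h).trans (F.map_id _)

theorem isMackey_postcomp (b : ∀ S : FinGSet G, BasePoints S)
    (F : BisetCatAdd G ⥤ AddCommGrpCat.{w}) [F.Additive] : IsMackey ((j b).postcomp F) where
  pullback h := by
    have := congrArg F.map (jMap_comp_jComap_of_isPullback h (b _) (b _) (b _) (b _))
    rwa [F.map_comp, F.map_comp] at this
  additive S₁ S₂ := by
    have h₁ := congrArg F.map
      (jMap_comp_jComap_of_injective (b _) (b (S₁.sum S₂)) (inl S₁ S₂) Sum.inl_injective)
    have h₂ := congrArg F.map
      (jMap_comp_jComap_of_injective (b _) (b (S₁.sum S₂)) (inr S₁ S₂) Sum.inr_injective)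
    have h₃ := congrArg F.map (jMap_comp_jComap_of_disjoint (b _) (b _) (b (S₁.sum S₂))
      (inl S₁ S₂) (inr S₁ S₂) fun _ _ => Sum.inl_ne_inr)
    have h₄ := congrArg F.map (jMap_comp_jComap_of_disjoint (b _) (b _) (b (S₁.sum S₂))
      (inr S₁ S₂) (inl S₁ S₂) fun _ _ => Sum.inr_ne_inl)
    have h₅ := congrArg F.map (sum_jComap_comp_jMap (U := fun l : Bool => cond l S₁ S₂)
      (fun l => b _) (b (S₁.sum S₂)) (fun l => match l with
        | true => inl S₁ S₂
        | false => inr S₁ S₂) (by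
          rintro (_ | _)
          · exact Sum.inr_injective
          · exact Sum.inl_injective) (by
          rintro (_ | _) (_ | _) x y e
          · rfl
          · exact absurd e Sum.inr_ne_inl
          · exact absurd e Sum.inl_ne_inr
          · rfl) (by
          rintro (x | x)
          · exact ⟨true, x, rfl⟩
          · exact ⟨false, x, rfl⟩))
    rw [Fintype.sum_bool, F.map_add] at h₅
    simp only [F.map_comp, F.map_id, F.map_zero] at h₁ h₂ h₃ h₄ h₅
    constructor
    · intro x y e
      have e₁ := congrArg Prod.fst e
      have e₂ := congrArg Prod.snd e
      have hx := ConcreteCategory.congr_hom h₅ x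
      have hy := ConcreteCategory.congr_hom h₅ y
      refine hx.symm.trans (Eq.trans ?_ hy)
      exact congrArg₂ (· + ·)
        (congrArg (ConcreteCategory.hom (F.map (jMap (b S₁) (b (S₁.sum S₂)) (inl S₁ S₂)))) e₁)
        (congrArg (ConcreteCategory.hom (F.map (jMap (b S₂) (b (S₁.sum S₂)) (inr S₁ S₂)))) e₂)
    · rintro ⟨x, y⟩
      refine ⟨ConcreteCategory.hom (F.map (jMap (b S₁) (b (S₁.sum S₂)) (inl S₁ S₂))) x +
        ConcreteCategory.hom (F.map (jMap (b S₂) (b (S₁.sum S₂)) (inr S₁ S₂))) y, ?_⟩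
      refine Prod.ext ?_ ?_
      · refine (map_add _ _ _).trans ?_
        refine (congrArg₂ (· + ·) (ConcreteCategory.congr_hom h₁ x)
          (ConcreteCategory.congr_hom h₄ y)).trans ?_
        exact add_zero x
      · refine (map_add _ _ _).trans ?_
        refine (congrArg₂ (· + ·) (ConcreteCategory.congr_hom h₃ x)
          (ConcreteCategory.congr_hom h₂ y)).trans ?_
        exact zero_add y
  empty := by
    have h : 𝟙 (b (FinGSet.empty G)).obj = 0 := by
      ext i
      exact PEmpty.elim ((b (FinGSet.empty G)).point i)
    have h' : 𝟙 (F.obj (b (FinGSet.empty G)).obj) = 0 := by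
      rw [← F.map_id, h, F.map_zero]
    have h0 : ∀ x : F.obj (b (FinGSet.empty G)).obj, x = 0 := fun x =>
      ConcreteCategory.congr_hom h' x
    exact ⟨fun x y => (h0 x).trans (h0 y).symm⟩

end Axioms

/-! ### Generation by spans and uniqueness -/

section Mat

variable {C : Type*} [Category C] [Preadditive C]

open scoped Classical in
/-- The matrix with the entry `x` at `(i, k)` and `0` elsewhere. -/
def matSingle {N N' : Mat_ C} (i : N.ι) (k : N'.ι) : (N.X i ⟶ N'.X k) →+ (N ⟶ N') :=
  (AddMonoidHom.single (fun i => ∀ k, N.X i ⟶ N'.X k) i).comp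
    (AddMonoidHom.single (fun k => N.X i ⟶ N'.X k) k)

theorem matSingle_apply_same {N N' : Mat_ C} (i : N.ι) (k : N'.ι) (x : N.X i ⟶ N'.X k) :
    matSingle i k x i k = x := by
  classical
  change (Pi.single i (Pi.single k x) : ∀ i k, N.X i ⟶ N'.X k) i k = x
  rw [Pi.single_eq_same, Pi.single_eq_same]

theorem matSingle_apply_of_ne {N N' : Mat_ C} {i i' : N.ι} {k k' : N'.ι} (x : N.X i ⟶ N'.X k)
    (h : i' = i → k' ≠ k) : matSingle i k x i' k' = 0 := by
  classical
  change (Pi.single i (Pi.single k x) : ∀ i k, N.X i ⟶ N'.X k) i' k' = 0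
  by_cases hi : i' = i
  · subst hi
    rw [Pi.single_eq_same, Pi.single_eq_of_ne (h rfl)]
  · rw [Pi.single_eq_of_ne hi]
    rfl

theorem sum_matSingle {N N' : Mat_ C} (m : N ⟶ N') :
    ∑ i, ∑ k, matSingle i k (m i k) = m := by
  classical
  have h₁ : ∀ i, ∑ k, matSingle i k (m i k) =
      (AddMonoidHom.single (fun i => ∀ k, N.X i ⟶ N'.X k) i) (m i) := by
    intro i
    refine (map_sum (AddMonoidHom.single (fun i => ∀ k, N.X i ⟶ N'.X k) i) _ _).symm.trans ?_
    exact congrArg _ (Finset.univ_sum_single (m i))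
  exact (Finset.sum_congr rfl fun i _ => h₁ i).trans
    (Finset.univ_sum_single (M := fun i => ∀ k, N.X i ⟶ N'.X k) m)

open scoped Classical in
/-- Tuples that agree up to a bijection of the index sets are isomorphic. -/
def matIsoOfEquiv {N N' : Mat_ C} (e : N.ι ≃ N'.ι) (h : ∀ i, N.X i = N'.X (e i)) : N ≅ N' where
  hom := fun i k => if hk : e i = k then eqToHom ((h i).trans (congrArg N'.X hk)) else 0
  inv := fun k i => if hk : e i = k then eqToHom ((h i).trans (congrArg N'.X hk)).symm else 0
  hom_inv_id := by
    ext i i'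
    change ∑ k,
      (if hk : e i = k then eqToHom ((h i).trans (congrArg N'.X hk)) else 0) ≫
      (if hk : e i' = k then eqToHom ((h i').trans (congrArg N'.X hk)).symm else 0) = _
    rw [Finset.sum_eq_single (e i)]
    · by_cases hi : i = i'
      · subst hi; simp
      · rw [dif_neg fun h => hi (e.injective h).symm, Limits.comp_zero,
          Mat_.id_apply_of_ne _ _ _ hi]
    · intro k _ hk
      rw [dif_neg hk.symm, Limits.zero_comp]
    · exact fun h => absurd (Finset.mem_univ _) h
  inv_hom_id := by
    ext k k'
    change ∑ i,
      (if hk : e i = k then eqToHom ((h i).trans (congrArg N'.X hk)).symm else 0) ≫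
      (if hk : e i = k' then eqToHom ((h i).trans (congrArg N'.X hk)) else 0) = _
    rw [Finset.sum_eq_single (e.symm k)]
    · by_cases hk : k = k'
      · subst hk; simp
      · rw [dif_neg (c := e (e.symm k) = k') (by rwa [e.apply_symm_apply]), Limits.comp_zero,
          Mat_.id_apply_of_ne _ _ _ hk]
    · intro i _ hi
      rw [dif_neg fun h => hi (by rw [← h, e.symm_apply_apply]), Limits.zero_comp]
    · exact fun h => absurd (Finset.mem_univ _) h

end Mat

theorem comp_iso_trans_symm {D : Type*} [Category D] {A A' B B' C C' : D} {a : A ⟶ A'}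
    {a' : B ⟶ B'} {c : C ⟶ C'} {x : A ≅ C} {x' : A' ≅ C'} {y : B ≅ C} {y' : B' ≅ C'}
    (h : a ≫ x'.hom = x.hom ≫ c) (h' : a' ≫ y'.hom = y.hom ≫ c) :
    a ≫ (x' ≪≫ y'.symm).hom = (x ≪≫ y.symm).hom ≫ a' := by
  simp only [Iso.trans_hom, Iso.symm_hom]
  rw [← Category.assoc, h, Category.assoc, Category.assoc, Iso.cancel_iso_hom_left,
    Iso.eq_inv_comp, ← Category.assoc, ← h', Category.assoc, Iso.hom_inv_id, Category.comp_id]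

/-- An isomorphism of functors is determined by, and may be given by, its components at a family of
objects that represents all isomorphism classes. -/
theorem existsUnique_iso_of_family {C D ι : Type*} [Category C] [Category D] {F F' : C ⥤ D}
    (X : ι → C) (hX : ∀ N, ∃ s, Nonempty (N ≅ X s)) (t : ∀ s, F.obj (X s) ≅ F'.obj (X s))
    (ht : ∀ s s' (m : X s ⟶ X s'), F.map m ≫ (t s').hom = (t s).hom ≫ F'.map m) :
    ∃! θ : F ≅ F', ∀ s, θ.hom.app (X s) = (t s).hom := by
  choose σ hσ using hX
  let r : ∀ N, N ≅ X (σ N) := fun N => (hσ N).some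
  let θ : F ≅ F' := NatIso.ofComponents
    (fun N => F.mapIso (r N) ≪≫ t (σ N) ≪≫ (F'.mapIso (r N)).symm) (by
      intro N N' m
      have h := ht _ _ ((r N).inv ≫ m ≫ (r N').hom)
      simp only [F.map_comp, F'.map_comp, Category.assoc] at h
      simp only [Iso.trans_hom, Iso.symm_hom, Functor.mapIso_hom, Functor.mapIso_inv,
        Category.assoc]
      rw [← cancel_epi (F.map (r N).inv), ← cancel_mono (F'.map (r N').hom)]
      simp only [Category.assoc, ← F'.map_comp, Iso.inv_hom_id, F'.map_id, Category.comp_id]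
      rw [h, ← F.map_comp_assoc (r N).inv, Iso.inv_hom_id, F.map_id, Category.id_comp]
      simp only [F'.map_comp])
  refine ⟨θ, fun s => ?_, fun θ' h => ?_⟩
  · change F.map (r (X s)).hom ≫ (t _).hom ≫ F'.map (r (X s)).inv = (t s).hom
    rw [← Category.assoc, ht, Category.assoc, ← F'.map_comp, Iso.hom_inv_id, F'.map_id,
      Category.comp_id]
  · ext N
    change θ'.hom.app N = F.map (r N).hom ≫ (t _).hom ≫ F'.map (r N).inv
    rw [← h, ← Category.assoc, θ'.hom.naturality, Category.assoc, ← F'.map_comp,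
      Iso.hom_inv_id, F'.map_id, Category.comp_id]

section Generation

variable [Finite G] {S T : FinGSet G}

/-- A biset `X` over `G` is the only nonzero entry of `j^*(q)` followed by `j_*(p)`, where `q` and
`p` are the legs of its span. -/
theorem jComap_legR_comp_jMap_legL (b : BasePoints S) (c : BasePoints T) (i : Fin b.num)
    (k : Fin c.num) (X : ConjBiset (c.obj.X k).sub (b.obj.X i).sub) {γ : X → G}
    (hγ : X.IsLabelling γ) (d : BasePoints X.apex) :
    jComap d b (legR hγ (b.point i) le_rfl) ≫ jMap d c (X.legL (c.point k) le_rfl) =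
      matSingle (N := b.obj) (N' := c.obj) i k (bisetHom X) := by
  ext i' k'
  let A : ∀ (i' : Fin b.num) (k' : Fin c.num), ConjBiset (c.obj.X k').sub (b.obj.X i').sub :=
    fun i' k' => spanBiset (MulAction.stabilizer G (c.point k'))
      (MulAction.stabilizer G (b.point i')) (legR hγ (b.point i) le_rfl)
      (X.legL (c.point k) le_rfl) (b.point i') (c.point k') le_rfl le_rfl
  have hA : ∀ i' k' (a : G) (x : X) (z : G), X.legL (c.point k) le_rfl (apexPt a x) = c.point k' →
      legR hγ (b.point i) le_rfl (apexPt a x) = z • b.point i' → i' = i ∧ k' = k := by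
    intro i' k' a x z h₁ h₂
    have h₁ : a • c.point k = c.point k' := h₁
    have h₂ : (a * γ x) • b.point i = z • b.point i' := h₂
    exact ⟨b.eq_of_mem (x := z • b.point i') ⟨z, rfl⟩ ⟨a * γ x, h₂⟩,
      c.eq_of_mem (x := c.point k') (MulAction.mem_orbit_self _) ⟨a, h₁⟩⟩
  refine (jComap_comp_jMap_apply b c d _ _ i' k').trans ?_
  by_cases h : i' = i ∧ k' = k
  · obtain ⟨rfl, rfl⟩ := h
    refine Eq.trans ?_ (matSingle_apply_same (N := b.obj) (N' := c.obj) i' k' (bisetHom X)).symm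
    refine (bisetHom_eq (Iso.of_bijective (X := X) (Y := A i' k')
      (fun x => ⟨(apexPt 1 x, γ x), ?_, ?_⟩) ⟨?_, ?_⟩ ?_ ?_)).symm
    · exact one_smul G _
    · change (1 * γ x) • b.point i' = γ x • b.point i'
      rw [one_mul]
    · intro x y e
      have e₁ : apexPt 1 x = apexPt 1 y := congrArg (fun x => x.1.1) e
      have e₂ : γ x = γ y := congrArg (fun x => x.1.2) e
      obtain ⟨a, h, h₁, rfl⟩ := apexPt_eq_iff.1 e₁
      have ha : a = 1 := Subtype.ext (by simpa using h₁.symm)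
      subst ha
      have hh : h = 1 := Subtype.ext (by simpa [hγ.right] using e₂)
      subst hh
      simp
    · rintro ⟨⟨u, z⟩, hp, hq⟩
      obtain ⟨a, x, rfl⟩ := apex_ind (P := fun u => ∃ a x, u = apexPt a x)
        (fun a x => ⟨a, x, rfl⟩) u
      have hp : a • c.point k' = c.point k' := hp
      have hq : (a * γ x) • b.point i' = z • b.point i' := hq
      have hz : (a * γ x)⁻¹ * z ∈ (b.obj.X i').sub := by
        change ((a * γ x)⁻¹ * z) • b.point i' = b.point i'
        rw [mul_smul, ← hq, inv_smul_smul]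
      refine ⟨(⟨a, hp⟩ : (c.obj.X k').sub) • op (⟨_, hz⟩ : (b.obj.X i').sub) • x,
        Subtype.ext (Prod.ext ?_ ?_)⟩
      · exact (apexPt_left 1 _ _).trans ((apexPt_right _ _ x).trans
          (congrArg (fun a => apexPt a x) (one_mul a)))
      · refine (hγ.smul_eq _ _ _).trans ?_
        exact mul_inv_cancel_left (a * γ x) z
    · intro a x
      refine Subtype.ext (Prod.ext ?_ (hγ.left a x))
      exact (apexPt_left 1 a x).trans (congrArg (fun a => apexPt a x)
        ((one_mul (a : G)).trans (mul_one (a : G)).symm))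
    · exact fun h x => Subtype.ext (Prod.ext (apexPt_right 1 h x) (hγ.right h x))
  · refine Eq.trans ?_ (matSingle_apply_of_ne (N := b.obj) (N' := c.obj) (i := i) (k := k)
      (bisetHom X) fun h₁ h₂ => h ⟨h₁, h₂⟩).symm
    refine @bisetHom_empty _ _ _ _ _ (A i' k') ⟨?_⟩
    rintro ⟨⟨u, z⟩, hp, hq⟩
    obtain ⟨a, x, rfl⟩ := apex_ind (P := fun u => ∃ a x, u = apexPt a x)
      (fun a x => ⟨a, x, rfl⟩) u
    exact h (hA i' k' a x z hp hq)

/-- The morphisms between objects of the form `j(S)` are generated by spans of `G`-maps. -/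
theorem mem_of_span_mem (b : ∀ S : FinGSet G, BasePoints S)
    (A : AddSubgroup ((b S).obj ⟶ (b T).obj))
    (hA : ∀ (U : FinGSet G) (q : U ⟶ S) (p : U ⟶ T),
      jComap (b U) (b S) q ≫ jMap (b U) (b T) p ∈ A) (m : (b S).obj ⟶ (b T).obj) : m ∈ A := by
  have key : ∀ (i : Fin (b S).num) (k : Fin (b T).num)
      (x : BisetGroup ((b T).obj.X k).sub ((b S).obj.X i).sub),
      matSingle (N := (b S).obj) (N' := (b T).obj) i k x ∈ A := by
    intro i k x
    -- The Grothendieck group is generated by the classes of bisets, which lie in `A`.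
    let f : BisetGroup ((b T).obj.X k).sub ((b S).obj.X i).sub →+ ((b S).obj ⟶ (b T).obj) ⧸ A :=
      (QuotientAddGroup.mk' A).comp (matSingle (N := (b S).obj) (N' := (b T).obj) i k)
    have hf : f = 0 := BisetGroup.hom_ext fun X => by
      obtain ⟨γ, hγ⟩ := X.exists_isLabelling
      have h := hA X.apex (legR hγ ((b S).point i) le_rfl) (X.legL ((b T).point k) le_rfl)
      rw [jComap_legR_comp_jMap_legL] at h
      exact (QuotientAddGroup.eq_zero_iff _).2 h
    exact (QuotientAddGroup.eq_zero_iff _).1 (DFunLike.congr_fun hf x)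
  rw [← sum_matSingle m]
  exact A.sum_mem fun i _ => A.sum_mem fun k _ => key i k _

/-- A tuple of subgroups `Hᵢ` consists of the stabilizers of the base points `eHᵢ` of the disjoint
union `S` of the `G/Hᵢ`, and different choices of base points of `S` give isomorphic objects. -/
theorem exists_iso_obj (b : ∀ S : FinGSet G, BasePoints S) (N : BisetCatAdd G) :
    ∃ S, Nonempty (N ≅ (b S).obj) := by
  let S : FinGSet G := { carrier := Σ i : N.ι, G ⧸ (N.X i).sub }
  let e : N.ι ≃ Fin (Fintype.card N.ι) := Fintype.equivFin N.ι
  let x : N.ι → S := fun i => ⟨i, ((1 : G) : G ⧸ (N.X i).sub)⟩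
  have hx : ∀ i (a : G), a • x i = (⟨i, (a : G ⧸ (N.X i).sub)⟩ : Σ i : N.ι, G ⧸ (N.X i).sub) :=
    fun i a => congrArg (Sigma.mk i) (congrArg QuotientGroup.mk (mul_one a))
  let c : BasePoints S :=
    { num := Fintype.card N.ι
      point := fun l => x (e.symm l)
      exists_unique := by
        rintro ⟨i, ⟨a⟩⟩
        refine ⟨e i, ⟨a, ?_⟩, ?_⟩
        · change a • x (e.symm (e i)) = _
          rw [e.symm_apply_apply]
          exact hx i a
        · rintro l ⟨a', h⟩
          have h' : a' • x (e.symm l) = _ := h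
          rw [hx] at h'
          rw [← e.symm_apply_eq]
          exact congrArg Sigma.fst h' }
  have hs : ∀ i, MulAction.stabilizer G (x i) = (N.X i).sub := by
    intro i
    ext a
    change a • x i = x i ↔ _
    rw [hx]
    constructor
    · intro h
      have h' : (a : G ⧸ (N.X i).sub) = ((1 : G) : G ⧸ (N.X i).sub) :=
        eq_of_heq (Sigma.mk.inj h).2
      simpa using QuotientGroup.eq.1 h'
    · intro h
      exact congrArg (Sigma.mk i) (QuotientGroup.eq.2 (by simpa using h))
  have hX : ∀ i, N.X i = c.obj.X (e i) := by
    intro i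
    change N.X i = ⟨MulAction.stabilizer G (x (e.symm (e i)))⟩
    rw [e.symm_apply_apply, hs]
  refine ⟨S, ⟨matIsoOfEquiv (N' := c.obj) e hX ≪≫
    { hom := jMap c (b S) (𝟙 S), inv := jMap (b S) c (𝟙 S), hom_inv_id := ?_, inv_hom_id := ?_ }⟩⟩
  · rw [← jMap_comp, Category.comp_id, jMap_id]
  · rw [← jMap_comp, Category.comp_id, jMap_id]

/-- A factorization of a bivariant functor through `j` and an additive functor is unique up to a
unique isomorphism. -/
theorem existsUnique_iso (b : ∀ S : FinGSet G, BasePoints S)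
    {M : Bivariant (FinGSet G) AddCommGrpCat.{w}} {F F' : BisetCatAdd G ⥤ AddCommGrpCat.{w}}
    [F.Additive] [F'.Additive] (η : Bivariant.NatIso ((j b).postcomp F) M)
    (η' : Bivariant.NatIso ((j b).postcomp F') M) :
    ∃! θ : F ≅ F', ∀ S : FinGSet G,
      θ.hom.app ((j b).obj S) ≫ (η'.app S).hom = (η.app S).hom := by
  let t : ∀ S : FinGSet G, F.obj (b S).obj ≅ F'.obj (b S).obj := fun S =>
    η.app S ≪≫ (η'.app S).symm
  have h₁ : ∀ {S T : FinGSet G} (f : S ⟶ T),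
      F.map (jMap (b S) (b T) f) ≫ (t T).hom = (t S).hom ≫ F'.map (jMap (b S) (b T) f) :=
    fun f => comp_iso_trans_symm (η.map_naturality f) (η'.map_naturality f)
  have h₂ : ∀ {S T : FinGSet G} (f : S ⟶ T),
      F.map (jComap (b S) (b T) f) ≫ (t S).hom = (t T).hom ≫ F'.map (jComap (b S) (b T) f) :=
    fun f => comp_iso_trans_symm (η.comap_naturality f) (η'.comap_naturality f)
  have key : ∀ (S T : FinGSet G) (m : (b S).obj ⟶ (b T).obj),
      F.map m ≫ (t T).hom = (t S).hom ≫ F'.map m := by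
    intro S T m
    let A : AddSubgroup ((b S).obj ⟶ (b T).obj) :=
      AddMonoidHom.eqLocus ((Preadditive.rightComp _ (t T).hom).comp F.mapAddHom)
        ((Preadditive.leftComp _ (t S).hom).comp F'.mapAddHom)
    refine mem_of_span_mem b A (fun U q p => ?_) m
    change F.map (_ ≫ _) ≫ _ = _ ≫ F'.map (_ ≫ _)
    rw [F.map_comp, F'.map_comp, Category.assoc, h₁, ← Category.assoc, h₂, Category.assoc]
  have hiff : ∀ (θ : F ≅ F') (S : FinGSet G), θ.hom.app ((j b).obj S) ≫ (η'.app S).hom =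
      (η.app S).hom ↔ θ.hom.app (b S).obj = (t S).hom := fun θ S =>
    (Iso.eq_comp_inv (η'.app S)).symm
  simp only [hiff]
  exact existsUnique_iso_of_family (fun S => (b S).obj) (exists_iso_obj b) t key

end Generation

end

end BisetMackey

theorem theoremA {G : Type u} [Group G] [Finite G] (b : ∀ S : FinGSet G, BasePoints S) :
    (∀ F : BisetCatAdd G ⥤ AddCommGrpCat.{w}, F.Additive →
      IsMackey ((j b).postcomp F) ∧ IsConjInvariant ((j b).postcomp F)) ∧
    (∀ M : Bivariant (FinGSet G) AddCommGrpCat.{w}, IsMackey M → IsConjInvariant M →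
      ∃ F : BisetCatAdd G ⥤ AddCommGrpCat.{w}, F.Additive ∧
        ∃ η : Bivariant.NatIso ((j b).postcomp F) M,
          ∀ F' : BisetCatAdd G ⥤ AddCommGrpCat.{w}, F'.Additive →
            ∀ η' : Bivariant.NatIso ((j b).postcomp F') M,
              ∃! θ : F ≅ F', ∀ S : FinGSet G,
                θ.hom.app ((j b).obj S) ≫ (η'.app S).hom = (η.app S).hom) := by
  refine ⟨fun F _ => ⟨isMackey_postcomp b F, isConjInvariant_postcomp b F⟩, fun M hM hC => ?_⟩
  exact ⟨matExtend (hM.bisetFunctor hC), inferInstance, hM.factorization hC b,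
    fun F' _ η' => existsUnique_iso b _ η'⟩
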